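/- **Setting.** A (3-)colex is a finite cell complex whose graph has at every vertex exactly one edge of each of four colours, whose faces and cells are the connected components of the subgraphs formed by the edges of two, respectively three, colours, and whose cells are polyhedra (each has a boundary homeomorphic to the 2-sphere); the colour of a cell is the colour missing in its edges. A *tetrahedral colex* is obtained from a closed colex by removing one vertex together with all edges, faces and cells that contain it, in such a way that the result is homeomorphic to a 3-ball. The trace of the removed $\kappa$-coloured cell is the $\kappa$-facet, so there are four facets, one of each colour. Let $\Phi_{\mathrm{all}}$ be the set of faces of a tetrahedral colex, and let $\phi+\phi'$ denote symmetric difference. A set of faces is a *syndrome* if, for some set $Q$ of vertices, it consists of the faces that have an odd number of vertices in $Q$; $\mathcal C$ is the set of syndromes. Let $C_i$ be a set of cells (for instance a member of a chain $C_1\subset\dots\subset C_n$ of sets of cells, $C_n$ being the set of all cells). Let $\Phi_i$ be the set of faces of the cells in $C_i$, $\overline{\Phi_i}=\Phi_{\mathrm{all}}\setminus\Phi_i$, and $$\mathcal C_i=\{\phi\subseteq\Phi_i \mid \exists\,\phi'\subseteq\overline{\Phi_i}:\ \phi+\phi'\in\mathcal C\}.$$ The *closure condition* with constant $k_{\mathrm{close}}$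 says that for every $\phi\in\mathcal C_i$ there is $\phi'\subseteq\overline{\Phi_i}$ with $|\phi'|\le k_{\mathrm{close}}|\phi|$ and $\phi+\phi'\in\mathcal C$. The dual graph has a vertex per cell and an edge per face, joining the two cells that the face is part of; an edge dual to a face on a facet has a single endpoint and is said to be connected to that facet. Let $\Gamma_i$ and $\overline{\Gamma_i}$ be its subgraphs formed by the edges dual to faces in $\Phi_i$ and in $\overline{\Phi_i}$, with the endpoints of these edges as vertices. In $\Gamma_i$, let $d(v,v')$ be the graph distance ($\infty$ if there is no path), $d_\kappa(v)$ the least number of edges of a path from $v$ to the $\kappa$-facet, counting the last edge, which is connected to the facet ($\infty$ if there is none), and $d(v)$ the sum of the two smallest of the four values $d_\kappa(v)$. Let $\overline d(v,v')$, $\overline d_\kappa(v)$, $\overline d(v)$ be the analogous quantities for $\overline{\Gamma_i}$. **Lemma.** Let $k\ge 0$ be real and let $k_{\mathrm{face}}$ be a natural number such that every cell of the tetrahedral colex has at most $k_{\mathrm{face}}$ faces. Suppose that - for every cell $c\notin C_i$, the set of points of $c$ that also belong to some element of $C_i$ is empty or simply connected, and - for any colour $\kappa$ and any $v,v'$ that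 are vertices of both $\Gamma_i$ and $\overline{\Gamma_i}$, $$\overline d(v,v')\le k\,d(v,v'),\qquad \min\bigl(\overline d_\kappa(v),\overline d(v)\bigr)\le k\,d_\kappa(v)$$ (with the convention $0\cdot\infty=0$). Then the closure condition holds with $k_{\mathrm{close}}=4k(k_{\mathrm{face}}-1)$. -/

import Mathlib

open scoped ENNReal NNReal symmDiff

/-- A closed 3-colex presented by its coloured graph: vertices `V`, and at every vertex exactly one
edge of each of the four colours (`nbr κ v` is the other end of the `κ`-edge at `v`).
One vertex `out` is marked: the colex with boundary that we study is what is left after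
removing `out` together with all edges, faces and cells that contain it. -/
structure ColexGraph (V : Type*) where
  nbr : Fin 4 → V → V
  nbr_nbr : ∀ κ v, nbr κ (nbr κ v) = v
  nbr_ne : ∀ κ v, nbr κ v ≠ v
  out : V

namespace ColexGraph

variable {V : Type*} (G : ColexGraph V)

/-- The set of vertices reachable from `v` along edges with colours in `s`. -/
def component (s : Finset (Fin 4)) (v : V) : Set V :=
  {w | Relation.ReflTransGen (fun x y => ∃ κ ∈ s, G.nbr κ x = y) v w}

/-- The elements (vertices, edges, faces, cells) of the colex: connected components of the
subgraphs formed by the edges with colours in a set `s` of at most three colours, those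
containing `out` being removed. The dimension of the element is the cardinality of `s`.
They are ordered by incidence: `(s, A) ≤ (t, B)` iff `s ⊆ t` and `A ⊆ B`. -/
abbrev Elem : Type _ :=
  {p : Finset (Fin 4) × Set V //
    p.1.card ≤ 3 ∧ (∃ v, p.2 = G.component p.1 v) ∧ G.out ∉ p.2}

/-- Faces (2-dimensional elements). Their edges have two alternating colours. -/
abbrev Face : Type _ := {e : G.Elem // e.1.1.card = 2}

/-- Cells (3-dimensional elements). The colour of a cell is the one missing in its edges. -/
abbrev Cell : Type _ := {e : G.Elem // e.1.1.card = 3}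

/-- The set of vertices of a face. -/
def verts (f : G.Face) : Set V := f.1.1.2

/-- The face `f` is part of the cell `c`. -/
def IsFaceOf (f : G.Face) (c : G.Cell) : Prop := f.1 ≤ c.1

/-- The face `f` belongs to the facet of colour `κ`. The `κ`-facet is the trace of the
removed `κ`-cell, the one that contains `out`. -/
def OnFacet (κ : Fin 4) (f : G.Face) : Prop :=
  f.1.1.1 ⊆ {κ}ᶜ ∧ G.verts f ⊆ G.component {κ}ᶜ G.out

end ColexGraph

/-- The geometric realization (inside `α → ℝ`, through barycentric coordinates) of the order
complex of a subset `S` of a finite partially ordered set. For the poset of elements of a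
regular cell complex it is the barycentric subdivision of that complex. -/
def realization {α : Type*} [PartialOrder α] (S : Set α) : Set (α → ℝ) :=
  {w | (∀ a, 0 ≤ w a) ∧ ∑ᶠ a, w a = 1 ∧ Function.support w ⊆ S ∧
    IsChain (· ≤ ·) (Function.support w)}

/-- A tetrahedral colex: finite, every cell is a polyhedron (its boundary is a topological
2-sphere), and the whole colex, whose boundary is made of the four facets left by the removal
of `out`, is a topological 3-ball. -/
structure TetrahedralColex (V : Type*) extends ColexGraph V where
  finite : Finite V
  cell_boundary : ∀ c : toColexGraph.Cell,
    Nonempty (realization (Set.Iio c.1) ≃ₜ Metric.sphere (0 : EuclideanSpace ℝ (Fin 3)) 1)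
  ball : Nonempty (realization (Set.univ : Set toColexGraph.Elem) ≃ₜ
    Metric.closedBall (0 : EuclideanSpace ℝ (Fin 3)) 1)

namespace TetrahedralColex

variable {V : Type*} (T : TetrahedralColex V)

abbrev Face : Type _ := T.toColexGraph.Face

abbrev Cell : Type _ := T.toColexGraph.Cell

/-- The set of points of a (closed) cell. -/
def points (c : T.Cell) : Set (T.toColexGraph.Elem → ℝ) := realization (Set.Iic c.1)

/-- The code `𝒞` of `X`-error syndromes. There is a qubit per vertex and a `Z`-type generator per
face, so the syndrome of an `X` error with support `Q` is the set of faces that share an odd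
number of vertices with `Q`. -/
def syndromes : Set (Set T.Face) :=
  {φ | ∃ Q : Set V, T.out ∉ Q ∧ φ = {f | Odd (T.verts f ∩ Q).ncard}}

/-- The set `Φ_C` of faces of the cells in `C`. -/
def facesOf (C : Set T.Cell) : Set T.Face := {f | ∃ c ∈ C, T.IsFaceOf f c}

/-- The code of the restrictions to `Φ` that can be completed outside `Φ` to a syndrome. -/
def partialCode (Φ : Set T.Face) : Set (Set T.Face) :=
  {φ | φ ⊆ Φ ∧ ∃ φ' ⊆ Φᶜ, φ ∆ φ' ∈ T.syndromes}

/-- The closure condition for the layer that is determined by the set of cells `C`. -/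
def ClosureCondition (C : Set T.Cell) (kclose : ℝ) : Prop :=
  ∀ φ ∈ T.partialCode (T.facesOf C), ∃ φ' ⊆ (T.facesOf C)ᶜ,
    (φ'.ncard : ℝ) ≤ kclose * φ.ncard ∧ φ ∆ φ' ∈ T.syndromes

/-- The subgraph of the dual graph with the edges dual to the faces in `Φ`, up to the multiplicity
of edges. (Edges dual to a face on a facet have a single endpoint and enter `facetDist` only.) -/
def dualGraph (Φ : Set T.Face) : SimpleGraph T.Cell where
  Adj c c' := c ≠ c' ∧ ∃ f ∈ Φ, T.IsFaceOf f c ∧ T.IsFaceOf f c'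
  symm := ⟨fun _ _ h => ⟨h.1.symm, h.2.imp fun _ hf => ⟨hf.1, hf.2.2, hf.2.1⟩⟩⟩
  loopless := ⟨fun _ h => h.1 rfl⟩

/-- The vertices of that subgraph: the endpoints of its edges. -/
def dualVertices (Φ : Set T.Face) : Set T.Cell := {c | ∃ f ∈ Φ, T.IsFaceOf f c}

/-- `d(v, v')` in the dual graph with edge set `Φ`; infinite if there is no path. -/
noncomputable def dist (Φ : Set T.Face) (v v' : T.Cell) : ℕ∞ := (T.dualGraph Φ).edist v v'

/-- `d_κ(v)`: the least number of edges of a path from `v` to the `κ`-facet in the dual graph with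
edge set `Φ`. The last edge of the path is the one connected to the facet. -/
noncomputable def facetDist (Φ : Set T.Face) (κ : Fin 4) (v : T.Cell) : ℕ∞ :=
  ⨅ (u : T.Cell) (_ : ∃ f ∈ Φ, T.IsFaceOf f u ∧ T.OnFacet κ f), T.dist Φ v u + 1

/-- `d(v)`: the sum of the two smallest of the four values `d_κ(v)`. -/
noncomputable def twoFacetDist (Φ : Set T.Face) (v : T.Cell) : ℕ∞ :=
  ⨅ (κ : Fin 4) (l : Fin 4) (_ : κ ≠ l), T.facetDist Φ κ v + T.facetDist Φ l v

end TetrahedralColex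

/-!
By linear duality over `𝔽₂`, a set `φ` of faces becomes a syndrome after adding faces of a set `M`
if and only if `∑ f ∈ φ, τ f = 0` for every function `τ` on faces that vanishes on `M` and whose sum
over the six faces at each vertex is zero. Such a `τ` is the coboundary of a potential. Colour the
edges of the complete graph `K₄` on the colours by `𝔽₂`; a cycle of `K₄` is a symmetric matrix whose
rows sum to zero and whose diagonal is zero. The potential assigns to every `κ`-coloured cell a
possible `κ`-th row of a cycle, and `τ f` is the sum of the two entries given by the two cells at
`f`. At each vertex this is linear algebra, with a cycle as the ambiguity; the cycles can be
adjusted globally because the ball has no first cohomology, and removing the interiors of its cells,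
which are bounded by spheres, creates none. On the cells removed together with the marked vertex the
potential is zero.

If `τ f = 0`, the two rows at `f` belong to a common cycle. Since a cell outside `C` meets the cells
of `C` in a simply connected set, its faces off these cells stay connected when one walks across
vertices, so the vanishing of `τ` on at most `2 (kface - 1)` faces forces the cycle of one such face
to fit the others. A tree in the complementary dual graph that joins the boundary cells of a
component of `φ` therefore forces all their rows to come from a single cycle, each edge costing at
most `2 (kface - 1)` faces. If the tree also reaches a facet, or two other facets, the
corresponding row of that cycle is zero. Adding the cycle to the potential on the component, and
replacing the potential by zero elsewhere, one sees that the sum of `τ` over the component is zero,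
because `φ` is the restriction of a syndrome.

The tree is small by the distance bounds: a closed walk runs through a component of `φ` in at most
twice as many steps as it has faces, and each step costs at most `k` edges of the tree. The product
of these bounds is `4 k (kface - 1) |φ|`.
-/

universe u

section Sphere

open Metric Module

variable {E : Type*} [NormedAddCommGroup E] [InnerProductSpace ℝ E]

theorem isPreconnected_compl_pair_neg [FiniteDimensional ℝ E] (hE : 2 < finrank ℝ E)
    (v : sphere (0 : E) 1) : IsPreconnected ({v}ᶜ ∩ {-v}ᶜ : Set (sphere (0 : E) 1)) := by
  have hv : ‖(v : E)‖ = 1 := norm_eq_of_mem_sphere v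
  have hrank : 1 < Module.rank ℝ (ℝ ∙ (v : E))ᗮ := by
    have hsum := (ℝ ∙ (v : E)).finrank_add_finrank_orthogonal
    rw [finrank_span_singleton (ne_zero_of_norm_ne_zero (by simp [hv]))] at hsum
    rw [← finrank_eq_rank]
    exact_mod_cast (by lia : 1 < finrank ℝ (ℝ ∙ (v : E))ᗮ)
  have hsymm : (stereographic hv).symm 0 = -v := by
    rw [← stereographic_apply_neg v]
    exact (stereographic hv).left_inv (by
      rw [stereographic_source]
      exact (ne_neg_of_mem_unit_sphere ℝ v).symm)
  have himage : (stereographic hv).symm '' {0}ᶜ = {v}ᶜ ∩ {-v}ᶜ := by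
    rw [Set.image_compl_eq_range_sdiff_image (isOpenEmbedding_stereographic_symm hv).injective,
      range_stereographic_symm hv v.2, Set.image_singleton, hsymm, Set.sdiff_eq]
  rw [← himage]
  exact (isConnected_compl_singleton_of_one_lt_rank hrank 0).isPreconnected.image _
    (isOpenEmbedding_stereographic_symm hv).continuous.continuousOn

end Sphere

section CechCocycle

open Topology

variable {X : Type*} [TopologicalSpace X] {G : Type*} [AddCommGroup G] [TopologicalSpace G]

/-- The family `s` trivializes over `A` the Čech cocycle with constant values `c i j` on the
sets `U i`. Continuity amounts to local constancy, since `G` is discrete in all applications. -/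
structure IsCechPrimitive {ι : Type*} (U : ι → Set X) (c : ι → ι → G) (A : Set X)
    (s : ι → X → G) : Prop where
  continuousOn : ∀ i, ContinuousOn (s i) (A ∩ U i)
  eq_add : ∀ i j, ∀ x ∈ A, x ∈ U i → x ∈ U j → s j x = s i x + c i j

variable (X G) in
/-- Every Čech cocycle with constant values in `G` on an open cover of `X` is trivial. For discrete
`G` this is a form of `H¹(X; G) = 0` that is accessible both from covering spaces and by gluing. -/
def CechTrivial : Prop :=
  ∀ (ι : Type u) (U : ι → Set X) (c : ι → ι → G), (∀ i, IsOpen (U i)) → (∀ x, ∃ i, x ∈ U i) →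
    (∀ i j k x, x ∈ U i → x ∈ U j → x ∈ U k → c i k = c i j + c j k) →
    ∃ s, IsCechPrimitive U c Set.univ s

namespace IsCechPrimitive

variable {ι : Type*} {U : ι → Set X} {c : ι → ι → G} {A B : Set X} {s t : ι → X → G}

theorem mono (hs : IsCechPrimitive U c B s) (h : A ⊆ B) : IsCechPrimitive U c A s :=
  ⟨fun i => (hs.continuousOn i).mono (Set.inter_subset_inter_left _ h),
    fun i j x hx => hs.eq_add i j x (h hx)⟩

variable [DiscreteTopology G]

theorem exists_eq_add_const (hU : ∀ i, IsOpen (U i)) (hcov : ∀ x, ∃ i, x ∈ U i) (hA : IsOpen A)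
    (hconn : IsPreconnected A) (hs : IsCechPrimitive U c A s) (ht : IsCechPrimitive U c A t) :
    ∃ d, ∀ x ∈ A, ∀ i, x ∈ U i → s i x = t i x + d := by
  choose idx hidx using hcov
  have diff_eq : ∀ x ∈ A, ∀ i j, x ∈ U i → x ∈ U j → s i x - t i x = s j x - t j x := by
    intro x hx i j hi hj
    rw [hs.eq_add i j x hx hi hj, ht.eq_add i j x hx hi hj]
    abel
  have hcont : ContinuousOn (fun x => s (idx x) x - t (idx x) x) A := by
    intro x hx
    have hnhds : A ∩ U (idx x) ∈ 𝓝 x := (hA.inter (hU _)).mem_nhds ⟨hx, hidx x⟩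
    have hdiff := ((hs.continuousOn (idx x)).sub (ht.continuousOn (idx x))).continuousAt hnhds
    refine (hdiff.congr ?_).continuousWithinAt
    filter_upwards [hnhds] with y hy using diff_eq y hy.1 _ _ hy.2 (hidx y)
  rcases A.eq_empty_or_nonempty with rfl | ⟨x₀, hx₀⟩
  · exact ⟨0, fun x hx => hx.elim⟩
  · refine ⟨s (idx x₀) x₀ - t (idx x₀) x₀, fun x hx i hi => ?_⟩
    rw [← hconn.constant hcont hx hx₀, diff_eq x hx (idx x) i (hidx x) hi, add_sub_cancel]

theorem exists_union (hU : ∀ i, IsOpen (U i)) (hcov : ∀ x, ∃ i, x ∈ U i) (hA : IsOpen A)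
    (hB : IsOpen B) (hconn : IsPreconnected (A ∩ B)) (hs : IsCechPrimitive U c A s)
    (ht : IsCechPrimitive U c B t) : ∃ r, IsCechPrimitive U c (A ∪ B) r := by
  classical
  obtain ⟨d, hd⟩ := (hs.mono Set.inter_subset_left).exists_eq_add_const hU hcov (hA.inter hB) hconn
    (ht.mono Set.inter_subset_right)
  have eq_t : ∀ i x, x ∈ B → x ∈ U i → A.piecewise (s i) (fun y => t i y + d) x = t i x + d := by
    intro i x hxB hi
    by_cases hxA : x ∈ A
    · rw [Set.piecewise_eq_of_mem _ _ _ hxA, hd x ⟨hxA, hxB⟩ i hi]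
    · exact Set.piecewise_eq_of_notMem _ _ _ hxA
  refine ⟨fun i => A.piecewise (s i) (fun x => t i x + d), fun i => ?_, ?_⟩
  · rw [Set.union_inter_distrib_right]
    refine ContinuousOn.union_of_isOpen ?_ ?_ (hA.inter (hU i)) (hB.inter (hU i))
    · exact (hs.continuousOn i).congr fun x hx => Set.piecewise_eq_of_mem _ _ _ hx.1
    · exact ((ht.continuousOn i).add continuousOn_const).congr fun x hx => eq_t i x hx.1 hx.2
  · rintro i j x (hx | hx) hi hj
    · simp only [Set.piecewise_eq_of_mem _ _ _ hx, hs.eq_add i j x hx hi hj]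
    · rw [eq_t i x hx hi, eq_t j x hx hj, ht.eq_add i j x hx hi hj]
      abel

end IsCechPrimitive

namespace CechTrivial

theorem of_homeomorph {Y : Type*} [TopologicalSpace Y] (hX : CechTrivial.{u} X G) (e : X ≃ₜ Y) :
    CechTrivial.{u} Y G := by
  intro ι U c hU hcov hc
  obtain ⟨s, hs⟩ := hX ι (fun i => e ⁻¹' U i) c (fun i => (hU i).preimage e.continuous)
    (fun x => hcov (e x)) (fun i j k x => hc i j k (e x))
  refine ⟨fun i y => s i (e.symm y), fun i => ?_, fun i j y _ hi hj => ?_⟩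
  · refine (hs.continuousOn i).comp e.symm.continuous.continuousOn fun y hy => ⟨trivial, ?_⟩
    simpa using hy.2
  · exact hs.eq_add i j _ trivial (by simpa using hi) (by simpa using hj)

theorem exists_isCechPrimitive {A : Set X} (hA : CechTrivial.{u} A G) {ι : Type u} {U : ι → Set X}
    {c : ι → ι → G} (hU : ∀ i, IsOpen (U i)) (hcov : ∀ x, ∃ i, x ∈ U i)
    (hc : ∀ i j k x, x ∈ U i → x ∈ U j → x ∈ U k → c i k = c i j + c j k) :
    ∃ s, IsCechPrimitive U c A s := by
  obtain ⟨s, hs⟩ := hA ι (fun i => Subtype.val ⁻¹' U i) c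
    (fun i => (hU i).preimage continuous_subtype_val) (fun x => hcov x) (fun i j k x => hc i j k x)
  have hext : ∀ i (x : A), Function.extend Subtype.val (s i) 0 (x : X) = s i x :=
    fun i => Subtype.val_injective.extend_apply (s i) 0
  refine ⟨fun i => Function.extend Subtype.val (s i) 0, fun i => ?_, fun i j x hx hi hj => ?_⟩
  · rw [← Subtype.image_preimage_val, IsInducing.subtypeVal.continuousOn_image_iff]
    refine (hs.continuousOn i).mono (by simp) |>.congr fun x _ => hext i x
  · rw [hext i ⟨x, hx⟩, hext j ⟨x, hx⟩, hs.eq_add i j ⟨x, hx⟩ trivial hi hj]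

theorem of_isOpen_union [DiscreteTopology G] {A B : Set X} (hA : IsOpen A) (hB : IsOpen B)
    (hAB : A ∪ B = Set.univ) (hconn : IsPreconnected (A ∩ B)) (tA : CechTrivial.{u} A G)
    (tB : CechTrivial.{u} B G) : CechTrivial.{u} X G := by
  intro ι U c hU hcov hc
  obtain ⟨s, hs⟩ := tA.exists_isCechPrimitive hU hcov hc
  obtain ⟨t, ht⟩ := tB.exists_isCechPrimitive hU hcov hc
  rw [← hAB]
  exact hs.exists_union hU hcov hA hB hconn ht

/-- The cocycle glues the trivial coverings `U i × G` to a covering of `X`; a section of that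
covering, read in the charts, is a primitive. -/
theorem of_simplyConnectedSpace [DiscreteTopology G] [SimplyConnectedSpace X]
    [LocallyPathConnectedSpace X] : CechTrivial.{u} X G := by
  intro ι U c hU hcov hc
  choose idx hidx using hcov
  let Z : FiberBundleCore ι X G :=
    { baseSet := U
      isOpen_baseSet := hU
      indexAt := idx
      mem_baseSet_at := hidx
      coordChange := fun i j _ v => v + c i j
      coordChange_self := fun i x hx v => by
        have : c i i = 0 := by simpa only [left_eq_add] using hc i i i x hx hx hx
        rw [this, add_zero]
      continuousOn_coordChange := fun i j =>
        (continuous_snd.add continuous_const).continuousOn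
      coordChange_comp := fun i j k x hx v => by
        rw [hc i j k x hx.1.1 hx.1.2 hx.2, add_assoc] }
  have hcovering : IsCoveringMap Z.proj := FiberBundle.isCoveringMap
  let x₀ : X := Nonempty.some inferInstance
  obtain ⟨F, ⟨-, hF⟩, -⟩ := hcovering.existsUnique_continuousMap_lifts (ContinuousMap.id X) x₀
    (⟨x₀, (0 : G)⟩ : Z.TotalSpace) rfl
  have hproj : ∀ x, (F x).proj = x := congrFun hF
  refine ⟨fun i x => (Z.localTriv i (F x)).2, fun i x hx => ?_, fun i j x _ hi hj => ?_⟩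
  · have hchart : ContinuousAt (Z.localTriv i) (F x) :=
      (Z.localTriv i).continuousAt (by
        rw [Z.mem_localTriv_source, ← Z.baseSet_at, hproj]
        exact hx.2)
    have hcomp : ContinuousAt (Z.localTriv i ∘ F) x := hchart.comp F.continuous.continuousAt
    exact hcomp.snd.continuousWithinAt
  · have hc' : c (idx x) j = c (idx x) i + c i j := hc (idx x) i j x (hidx x) hi hj
    simp only [FiberBundleCore.localTriv_apply, hproj]
    exact (congrArg (fun g : G => (show G from (F x).snd) + g) hc').trans
      (add_assoc (G := G) _ _ _).symm

section Sphere

open Metric Module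

variable {E : Type*} [NormedAddCommGroup E] [InnerProductSpace ℝ E]

theorem compl_singleton_sphere [DiscreteTopology G] (v : sphere (0 : E) 1) :
    CechTrivial.{u} ({v}ᶜ : Set (sphere (0 : E) 1)) G := by
  have hv : ‖(v : E)‖ = 1 := norm_eq_of_mem_sphere v
  have e := (isOpenEmbedding_stereographic_symm hv).isEmbedding.toHomeomorph
  rw [range_stereographic_symm hv v.2] at e
  have plane : CechTrivial.{u} (ℝ ∙ (v : E))ᗮ G := of_simplyConnectedSpace
  exact plane.of_homeomorph e

theorem sphere [DiscreteTopology G] [FiniteDimensional ℝ E] (hE : 2 < finrank ℝ E) :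
    CechTrivial.{u} (sphere (0 : E) 1) G := by
  have : Nontrivial E := nontrivial_of_finrank_pos (R := ℝ) (by lia)
  obtain ⟨e, he⟩ := exists_norm_eq E zero_le_one
  let v : Metric.sphere (0 : E) 1 := ⟨e, by simp [he]⟩
  refine of_isOpen_union isOpen_compl_singleton isOpen_compl_singleton ?_
    (isPreconnected_compl_pair_neg hE v) (compl_singleton_sphere v) (compl_singleton_sphere (-v))
  rw [← Set.compl_inter, Set.singleton_inter_eq_empty.2, Set.compl_empty]
  exact ne_neg_of_mem_unit_sphere ℝ v

end Sphere

end CechTrivial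

end CechCocycle

section Realization

open Topology

theorem isOpen_setOf_support_subset {α : Type*} [Finite α] (v : α → ℝ) :
    IsOpen {w : α → ℝ | Function.support v ⊆ Function.support w} := by
  simp only [Set.subset_def, Function.mem_support, Set.ofPred_forall]
  exact Set.Finite.isOpen_biInter (Set.toFinite (Function.support v))
    fun x _ => isOpen_ne_fun (continuous_apply x) continuous_const

variable {α : Type u} [PartialOrder α] {S : Set α}

/-- Every `G`-valued 1-cocycle on the order relation of `S` is a coboundary, that is, the order
complex of `S` has trivial first cohomology with coefficients in `G`. -/
def OrderAcyclic (S : Set α) (G : Type*) [AddCommGroup G] : Prop :=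
  ∀ h : α → α → G, (∀ x ∈ S, ∀ y ∈ S, ∀ z ∈ S, x ≤ y → y ≤ z → h x z = h x y + h y z) →
    ∃ g : α → G, ∀ x ∈ S, ∀ y ∈ S, x ≤ y → h x y = g y - g x

/-- The open star of the simplex of the order complex that contains `v` in its interior. -/
def realizationStar (S : Set α) (v : α → ℝ) : Set (α → ℝ) :=
  {w ∈ realization S | Function.support v ⊆ Function.support w}

theorem starConvex_realizationStar [Finite α] {v : α → ℝ} (hv : v ∈ realization S) :
    StarConvex ℝ v (realizationStar S v) := by
  have := Fintype.ofFinite α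
  rintro w ⟨hw, hvw⟩ a b ha hb hab
  obtain ⟨v_nonneg, v_sum, -, -⟩ := hv
  obtain ⟨w_nonneg, w_sum, w_support, w_chain⟩ := hw
  have support_le : Function.support (a • v + b • w) ⊆ Function.support w := by
    intro x hx hwx
    have hvx : v x = 0 := Function.notMem_support.1 fun hv => hvw hv hwx
    exact hx (by simp [hvx, hwx])
  refine ⟨⟨fun x => ?_, ?_, support_le.trans w_support, w_chain.mono support_le⟩, fun x hx => ?_⟩
  · exact add_nonneg (mul_nonneg ha (v_nonneg x)) (mul_nonneg hb (w_nonneg x))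
  · rw [finsum_eq_sum_of_fintype] at v_sum w_sum ⊢
    simp only [Pi.add_apply, Pi.smul_apply, smul_eq_mul, Finset.sum_add_distrib, ← Finset.mul_sum,
      v_sum, w_sum, mul_one, hab]
  · have hvx : 0 < v x := (v_nonneg x).lt_of_ne' hx
    have hwx : 0 < w x := (w_nonneg x).lt_of_ne' (hvw hx)
    exact (convex_Ioi (0 : ℝ) hvx hwx ha hb hab).ne'

theorem locallyPathConnectedSpace_realization [Finite α] (S : Set α) :
    LocallyPathConnectedSpace (realization S) := by
  have := Fintype.ofFinite α
  have basis (v : realization S) : (𝓝 v).HasBasis (fun ε : ℝ => 0 < ε) fun ε =>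
      Subtype.val ⁻¹' (Metric.ball (v : α → ℝ) ε ∩ realizationStar S v) := by
    have hstar : Subtype.val ⁻¹' realizationStar S (v : α → ℝ) ∈ 𝓝 v := by
      have hopen := (isOpen_setOf_support_subset (v : α → ℝ)).preimage
        (continuous_subtype_val (p := (· ∈ realization S)))
      filter_upwards [hopen.mem_nhds (Set.Subset.refl _)] with w hw using ⟨w.2, hw⟩
    refine ⟨fun t => ⟨fun ht => ?_, fun ⟨ε, hε, hsub⟩ => ?_⟩⟩
    · obtain ⟨ε, hε, hsub⟩ := Metric.mem_nhds_iff.1 ht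
      exact ⟨ε, hε, fun w hw => hsub hw.1⟩
    · exact Filter.mem_of_superset (Filter.inter_mem (Metric.ball_mem_nhds v hε) hstar) hsub
  refine LocallyPathConnectedSpace.of_bases basis fun v ε hε => IsPathConnected.preimage_coe ?_ ?_
  · have hv : (v : α → ℝ) ∈ realizationStar S v := ⟨v.2, Set.Subset.rfl⟩
    refine StarConvex.isPathConnected (a := (v : α → ℝ)) ?_ ⟨Metric.mem_ball_self hε, hv⟩
    exact ((convex_ball _ _).starConvex (Metric.mem_ball_self hε)).inter
      (starConvex_realizationStar v.2)
  · exact fun w hw => hw.2.1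

theorem exists_mem_realization_support_eq {A : Finset α} (hne : A.Nonempty) (hA : (A : Set α) ⊆ S)
    (hchain : IsChain (· ≤ ·) (A : Set α)) : ∃ w ∈ realization S, Function.support w = A := by
  classical
  have hcard : (A.card : ℝ) ≠ 0 := by exact_mod_cast hne.card_ne_zero
  have hsupport : Function.support (fun x => if x ∈ A then (A.card : ℝ)⁻¹ else 0) = A := by
    ext x
    simp [hne.ne_empty]
  refine ⟨_, ⟨fun x => ?_, ?_, hsupport.trans_subset hA, hsupport ▸ hchain⟩, hsupport⟩
  · positivity
  · rw [finsum_eq_sum_of_support_subset _ hsupport.subset]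
    simp [hcard]

theorem isPreconnected_setOf_mem_support [Finite α] (S : Set α) (x : α) :
    IsPreconnected {w : realization S | x ∈ Function.support w.1} := by
  rcases Set.eq_empty_or_nonempty {w : realization S | x ∈ Function.support w.1} with h | ⟨w, hw⟩
  · exact h ▸ isPreconnected_empty
  obtain ⟨v, hv, hsupport⟩ := exists_mem_realization_support_eq (A := {x}) (S := S) (by simp)
    (by simpa using w.2.2.2.1 hw) (by simp)
  have hpath := (starConvex_realizationStar hv).isPathConnected ⟨hv, Set.Subset.rfl⟩
  have := (hpath.preimage_coe fun w hw => hw.1).isConnected.isPreconnected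
  simpa [realizationStar, hsupport] using this

open Classical in
/-- The antisymmetric extension of `h` from the pairs `x ≤ y` to all comparable pairs. -/
noncomputable def antisymmExtension {G : Type*} [AddCommGroup G] (h : α → α → G) (x y : α) : G :=
  if x ≤ y then h x y else -h y x

theorem antisymmExtension_eq_sub {G : Type*} [AddCommGroup G] {h : α → α → G}
    (hh : ∀ x ∈ S, ∀ y ∈ S, ∀ z ∈ S, x ≤ y → y ≤ z → h x z = h x y + h y z) {m x y : α}
    (hm : m ∈ S) (hx : x ∈ S) (hy : y ∈ S) (hmx : m ≤ x) (hmy : m ≤ y) (hxy : x ≤ y ∨ y ≤ x) :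
    antisymmExtension h x y = h m y - h m x := by
  by_cases hle : x ≤ y
  · rw [antisymmExtension, if_pos hle, hh m hm x hx y hy hmx hle, add_sub_cancel_left]
  · have hge := hxy.resolve_left hle
    rw [antisymmExtension, if_neg hle, hh m hm y hy x hx hmy hge, sub_add_cancel_left]

theorem antisymmExtension_add {G : Type*} [AddCommGroup G] {h : α → α → G}
    (hh : ∀ x ∈ S, ∀ y ∈ S, ∀ z ∈ S, x ≤ y → y ≤ z → h x z = h x y + h y z) {A : Set α}
    (hAS : A ⊆ S) (hA : IsChain (· ≤ ·) A) {x y z : α} (hx : x ∈ A) (hy : y ∈ A) (hz : z ∈ A) :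
    antisymmExtension h x z = antisymmExtension h x y + antisymmExtension h y z := by
  have hA' : IsChain (· ≥ ·) A := hA.symm
  obtain ⟨l, hl, hlx, hly⟩ := hA'.directedOn x hx y hy
  obtain ⟨m, hm, hml, hmz⟩ := hA'.directedOn l hl z hz
  have eq_sub {a b : α} (ha : a ∈ A) (hb : b ∈ A) (hma : m ≤ a) (hmb : m ≤ b) :
      antisymmExtension h a b = h m b - h m a :=
    antisymmExtension_eq_sub hh (hAS hm) (hAS ha) (hAS hb) hma hmb (hA.total ha hb)
  rw [eq_sub hx hz (hml.trans hlx) hmz, eq_sub hx hy (hml.trans hlx) (hml.trans hly),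
    eq_sub hy hz (hml.trans hly) hmz]
  abel

/-- The open stars of the vertices cover the realization, and they meet exactly when the vertices
are comparable, so that a cocycle on the order relation is a Čech cocycle on this cover. -/
theorem OrderAcyclic.of_cechTrivial [Finite α] {G : Type*} [AddCommGroup G] [TopologicalSpace G]
    [DiscreteTopology G] (hS : CechTrivial.{u} (realization S) G) : OrderAcyclic S G := by
  classical
  intro h hh
  obtain ⟨s, hs⟩ := hS α (fun x => {w | x ∈ Function.support w.1}) (antisymmExtension h)
    (fun x => isOpen_ne_fun ((continuous_apply x).comp continuous_subtype_val) continuous_const)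
    (fun w => Function.support_nonempty_iff.2 fun h0 => by simpa [h0] using w.2.2.1)
    (fun x y z w => antisymmExtension_add hh w.2.2.2.1 w.2.2.2.2)
  have constant {x : α} {v w : realization S} (hv : x ∈ Function.support v.1)
      (hw : x ∈ Function.support w.1) : s x v = s x w :=
    (isPreconnected_setOf_mem_support S x).constant
      ((hs.continuousOn x).mono fun v hv => ⟨trivial, hv⟩) hv hw
  have value (x : α) : ∃ g, ∀ w : realization S, x ∈ Function.support w.1 → s x w = g := by
    by_cases hx : ∃ v : realization S, x ∈ Function.support v.1
    · exact hx.elim fun v hv => ⟨s x v, fun w hw => constant hw hv⟩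
    · exact ⟨0, fun w hw => absurd ⟨w, hw⟩ hx⟩
  choose g hg using value
  refine ⟨g, fun x hx y hy hxy => ?_⟩
  obtain ⟨w, hw, hsupport⟩ := exists_mem_realization_support_eq (A := {x, y}) (S := S) (by simp)
    (by simp [Set.insert_subset_iff, hx, hy]) (by simpa using IsChain.pair hxy)
  have hwx : x ∈ Function.support w := hsupport ▸ by simp
  have hwy : y ∈ Function.support w := hsupport ▸ by simp
  rw [← hg x ⟨w, hw⟩ hwx, ← hg y ⟨w, hw⟩ hwy, hs.eq_add x y ⟨w, hw⟩ trivial hwx hwy,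
    antisymmExtension, if_pos hxy, add_sub_cancel_left]

theorem OrderAcyclic.of_isSimplyConnected [Finite α] (hS : IsSimplyConnected (realization S))
    (G : Type*) [AddCommGroup G] : OrderAcyclic S G := by
  let _ : TopologicalSpace G := ⊥
  have : DiscreteTopology G := ⟨rfl⟩
  have := hS.simplyConnectedSpace
  have := locallyPathConnectedSpace_realization S
  exact .of_cechTrivial .of_simplyConnectedSpace

theorem OrderAcyclic.of_homeomorph_closedBall [Finite α] {E : Type*} [NormedAddCommGroup E]
    [NormedSpace ℝ E] (e : realization S ≃ₜ Metric.closedBall (0 : E) 1)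
    (G : Type*) [AddCommGroup G] : OrderAcyclic S G := by
  have : ContractibleSpace (Metric.closedBall (0 : E) 1) :=
    (convex_closedBall _ _).contractibleSpace ⟨0, by simp⟩
  exact .of_isSimplyConnected e.toHomotopyEquiv.simplyConnectedSpace G

theorem OrderAcyclic.of_homeomorph_sphere [Finite α] {E : Type*} [NormedAddCommGroup E]
    [InnerProductSpace ℝ E] [FiniteDimensional ℝ E] (hE : 2 < Module.finrank ℝ E)
    (e : realization S ≃ₜ Metric.sphere (0 : E) 1) (G : Type*) [AddCommGroup G] :
    OrderAcyclic S G := by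
  let _ : TopologicalSpace G := ⊥
  have : DiscreteTopology G := ⟨rfl⟩
  exact .of_cechTrivial ((CechTrivial.sphere hE).of_homeomorph e.symm)

end Realization

theorem OrderAcyclic.compl_of_isMax {α : Type*} [PartialOrder α] {A : Type*} [AddCommGroup A]
    {M : Set α} (hM : ∀ c ∈ M, IsMax c) (hlink : ∀ c ∈ M, OrderAcyclic (Set.Iio c) A)
    (hall : OrderAcyclic (Set.univ : Set α) A) : OrderAcyclic Mᶜ A := by
  classical
  intro h hh
  have notMem {x y : α} (hxy : x ≤ y) (hy : y ∉ M) : x ∉ M := fun hx =>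
    hy ((hM x hx).eq_of_le hxy ▸ hx)
  have notMem_of_lt {x y : α} (hxy : x < y) : x ∉ M := fun hx => (hM x hx).not_lt hxy
  have primitive (c : M) : ∃ g : α → A, ∀ x ∈ Set.Iio c.1, ∀ y ∈ Set.Iio c.1, x ≤ y →
      h x y = g y - g x :=
    hlink c c.2 h fun x hx y hy w hw =>
      hh x (notMem_of_lt hx) y (notMem_of_lt hy) w (notMem_of_lt hw)
  choose γ hγ using primitive
  let k (x y : α) : A := if hy : y ∈ M then if x ∈ M then 0 else -γ ⟨y, hy⟩ x else h x y
  have k_add (x y w : α) (hxy : x ≤ y) (hyw : y ≤ w) : k x w = k x y + k y w := by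
    by_cases hw : w ∈ M
    · by_cases hy : y ∈ M
      · obtain rfl := (hM y hy).eq_of_le hyw
        simp [k, hw]
      · have hyw' : y < w := hyw.lt_of_ne fun e => hy (e ▸ hw)
        simp only [k, hw, hy, notMem hxy hy, dite_true, dite_false, if_false,
          hγ ⟨w, hw⟩ x (hxy.trans_lt hyw') y hyw' hxy]
        abel
    · have hy := notMem hyw hw
      simpa only [k, hw, hy, dite_false] using hh x (notMem hxy hy) y hy w hw hxy hyw
  obtain ⟨g, hg⟩ := hall k fun x _ y _ w _ => k_add x y w
  refine ⟨g, fun x _ y (hy : y ∉ M) hxy => ?_⟩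
  rw [← hg x trivial y trivial hxy]
  simp only [k, hy, dite_false]

section Colours

/-- The functions modulo 2 on the three edges at the vertex `κ` of the complete graph on the four
colours that have an even sum. They are the values that a cycle can take at `κ`. -/
def rowSpace (κ : Fin 4) : Submodule (ZMod 2) (Fin 4 → ZMod 2) where
  carrier := {a | a κ = 0 ∧ ∑ l, a l = 0}
  zero_mem' := by simp
  add_mem' := fun ha hb => ⟨by simp [ha.1, hb.1], by simp [Finset.sum_add_distrib, ha.2, hb.2]⟩
  smul_mem' := fun c _ ha => ⟨by simp [ha.1], by simp [← Finset.mul_sum, ha.2]⟩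

/-- The cycle space modulo 2 of the complete graph on the four colours; a cycle is encoded by the
symmetric matrix of its values on the edges. -/
def cycleSpace : Submodule (ZMod 2) (Fin 4 → Fin 4 → ZMod 2) where
  carrier := {z | (∀ κ l, z κ l = z l κ) ∧ ∀ κ, z κ ∈ rowSpace κ}
  zero_mem' := ⟨fun _ _ => rfl, fun κ => (rowSpace κ).zero_mem⟩
  add_mem' := fun ha hb => ⟨fun κ l => congrArg₂ (· + ·) (ha.1 κ l) (hb.1 κ l),
    fun κ => (rowSpace κ).add_mem (ha.2 κ) (hb.2 κ)⟩
  smul_mem' := fun c _ ha => ⟨fun κ l => congrArg (c • ·) (ha.1 κ l),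
    fun κ => (rowSpace κ).smul_mem c (ha.2 κ)⟩

/-- The cycle formed by the three edges of the complete graph on the colours that avoid `x`. -/
def triangle (x i j : Fin 4) : ZMod 2 := if i = j ∨ i = x ∨ j = x then 0 else 1

theorem triangle_mem_cycleSpace (x : Fin 4) : triangle x ∈ cycleSpace := by
  change _ ∧ ∀ κ, _ ∧ _
  revert x
  decide

variable {κ l m : Fin 4} {a b : Fin 4 → ZMod 2} {z : Fin 4 → Fin 4 → ZMod 2}

theorem eq_of_mem_rowSpace (hκl : κ ≠ l) (hκm : κ ≠ m) (hlm : l ≠ m) (ha : a ∈ rowSpace m)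
    (hb : b ∈ rowSpace m) (hκ : a κ = b κ) (hl : a l = b l) : a = b := by
  obtain ⟨hm, hsum⟩ := (rowSpace m).sub_mem ha hb
  refine sub_eq_zero.1 <| funext fun n => ?_
  by_cases hn : n = κ ∨ n = l ∨ n = m
  · obtain rfl | rfl | rfl := hn
    exacts [sub_eq_zero.2 hκ, sub_eq_zero.2 hl, hm]
  · refine (Finset.sum_eq_single n (fun i _ hi => ?_) (by simp)).symm.trans hsum
    obtain rfl | rfl | rfl : i = κ ∨ i = l ∨ i = m := by omega
    exacts [sub_eq_zero.2 hκ, sub_eq_zero.2 hl, hm]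

theorem row_eq_of_row_eq (hz : z ∈ cycleSpace) (hκl : κ ≠ l) (hκm : κ ≠ m) (hlm : l ≠ m)
    (ha : a ∈ rowSpace m) (hκ : z κ m = a κ) (hl : z l m = a l) : z m = a :=
  eq_of_mem_rowSpace hκl hκm hlm (hz.2 m) ha (hz.1 m κ ▸ hκ) (hz.1 m l ▸ hl)

theorem eq_zero_of_mem_cycleSpace (hz : z ∈ cycleSpace) (hκl : κ ≠ l) (hκ : z κ = 0)
    (hl : z l = 0) : z = 0 := by
  funext m
  obtain rfl | hκm := eq_or_ne κ m
  · exact hκ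
  obtain rfl | hlm := eq_or_ne l m
  · exact hl
  exact row_eq_of_row_eq hz hκl hκm hlm (rowSpace m).zero_mem (by simp [hκ]) (by simp [hl])

theorem exists_mem_cycleSpace_of_rows (hκl : κ ≠ l) (ha : a ∈ rowSpace κ) (hb : b ∈ rowSpace l)
    (hab : a l = b κ) : ∃ z ∈ cycleSpace, z κ = a ∧ z l = b := by
  obtain ⟨m, n, hmκ, hml, hnκ, hnl, hnm⟩ :
      ∃ m n, m ≠ κ ∧ m ≠ l ∧ n ≠ κ ∧ n ≠ l ∧ n ≠ m := by
    clear ha hb hab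
    revert κ l
    decide
  have hz : a l • triangle n + (a m - a l) • triangle l + (b m - a l) • triangle κ ∈ cycleSpace :=
    add_mem (add_mem (cycleSpace.smul_mem _ (triangle_mem_cycleSpace _))
      (cycleSpace.smul_mem _ (triangle_mem_cycleSpace _)))
      (cycleSpace.smul_mem _ (triangle_mem_cycleSpace _))
  refine ⟨_, hz, eq_of_mem_rowSpace hml.symm hκl.symm hmκ (hz.2 κ) ha ?_ ?_,
    eq_of_mem_rowSpace hmκ.symm hκl hml (hz.2 l) hb ?_ ?_⟩
  all_goals simp [triangle, hκl, hκl.symm, hmκ, hmκ.symm, hml, hml.symm, hnκ.symm, hnl.symm,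
    hnm.symm, hab]

theorem exists_ne_ne (κ l : Fin 4) : ∃ m, m ≠ κ ∧ m ≠ l := by
  revert κ l; decide

theorem exists_mem_cycleSpace_of_row (ha : a ∈ rowSpace κ) : ∃ z ∈ cycleSpace, z κ = a := by
  obtain ⟨l, hlκ, -⟩ := exists_ne_ne κ κ
  obtain ⟨m, hmκ, hml⟩ := exists_ne_ne κ l
  have hb : Pi.single κ (a l) + Pi.single m (a l) ∈ rowSpace l := by
    refine ⟨by simp [hlκ, hml.symm], ?_⟩
    simpa [Finset.sum_add_distrib] using CharTwo.add_self_eq_zero (a l)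
  obtain ⟨z, hz, hzκ, -⟩ := exists_mem_cycleSpace_of_rows hlκ.symm ha hb (by simp [hmκ.symm])
  exact ⟨z, hz, hzκ⟩

theorem sum_powersetCard_two {M : Type*} [AddCommMonoid M] (t : Finset (Fin 4) → M) :
    ∑ s ∈ Finset.powersetCard 2 Finset.univ, t s =
      t {0, 1}ᶜ + (t {0, 2}ᶜ + (t {0, 3}ᶜ + (t {1, 2}ᶜ + (t {1, 3}ᶜ + t {2, 3}ᶜ)))) := by
  have pairs : Finset.powersetCard 2 (Finset.univ : Finset (Fin 4)) =
      {{0, 1}ᶜ, {0, 2}ᶜ, {0, 3}ᶜ, {1, 2}ᶜ, {1, 3}ᶜ, {2, 3}ᶜ} := by decide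
  rw [pairs, Finset.sum_insert (by decide), Finset.sum_insert (by decide),
    Finset.sum_insert (by decide), Finset.sum_insert (by decide), Finset.sum_insert (by decide),
    Finset.sum_singleton]

theorem exists_rows_of_sum_eq_zero {t : Finset (Fin 4) → ZMod 2}
    (ht : ∑ s ∈ Finset.powersetCard 2 Finset.univ, t s = 0) :
    ∃ a : Fin 4 → Fin 4 → ZMod 2, (∀ κ, a κ ∈ rowSpace κ) ∧
      ∀ κ l, κ ≠ l → a κ l + a l κ = t {κ, l}ᶜ := by
  rw [sum_powersetCard_two] at ht
  let u (κ l : Fin 4) : ZMod 2 := t {κ, l}ᶜ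
  have u_comm (κ l : Fin 4) : u κ l = u l κ := by simp only [u, Finset.pair_comm]
  refine ⟨![![0, 0, 0, 0], ![u 0 1, 0, u 0 1, 0], ![u 0 2, u 1 2 + u 0 1, 0, u 0 2 + u 1 2 + u 0 1],
    ![u 0 3, u 1 3, u 2 3 + (u 0 2 + u 1 2 + u 0 1), 0]], fun κ => ?_, fun κ l hκl => ?_⟩
  · change _ = _ ∧ _ = _
    fin_cases κ <;> simp [Fin.sum_univ_four] <;> grind
  · change _ = u κ l
    fin_cases κ <;> fin_cases l <;> first | exact absurd rfl hκl | simp <;> grind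

/-- Adding the cycle `z` turns the rows `b` into the rows `a`, for the colours outside `s`. -/
structure Transports (s : Finset (Fin 4)) (a b z : Fin 4 → Fin 4 → ZMod 2) : Prop where
  mem_cycleSpace : z ∈ cycleSpace
  eq_sub : ∀ κ ∉ s, z κ = a κ - b κ

namespace Transports

variable {s t : Finset (Fin 4)} {a b c z z' : Fin 4 → Fin 4 → ZMod 2}

theorem mono (hst : s ⊆ t) (h : Transports s a b z) : Transports t a b z :=
  ⟨h.1, fun κ hκ => h.2 κ fun hs => hκ (hst hs)⟩

theorem add (h : Transports s a b z) (h' : Transports s b c z') : Transports s a c (z + z') :=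
  ⟨cycleSpace.add_mem h.1 h'.1, fun κ hκ => by simp [h.2 κ hκ, h'.2 κ hκ]⟩

theorem exists_ne_notMem (hs : s.card ≤ 2) : ∃ κ l : Fin 4, κ ≠ l ∧ κ ∉ s ∧ l ∉ s := by
  revert s; decide

theorem unique (hs : s.card ≤ 2) (h : Transports s a b z) (h' : Transports s a b z') :
    z = z' := by
  obtain ⟨κ, l, hκl, hκ, hl⟩ := exists_ne_notMem hs
  exact sub_eq_zero.1 <| eq_zero_of_mem_cycleSpace (cycleSpace.sub_mem h.1 h'.1) hκl
    (by simp [h.2 κ hκ, h'.2 κ hκ]) (by simp [h.2 l hl, h'.2 l hl])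

theorem exists_of_add_eq (hs : s.card ≤ 2) (ha : ∀ κ, a κ ∈ rowSpace κ)
    (hb : ∀ κ, b κ ∈ rowSpace κ)
    (hab : ∀ κ l, κ ∉ s → l ∉ s → κ ≠ l → a κ l + a l κ = b κ l + b l κ) :
    ∃ z, Transports s a b z := by
  obtain ⟨κ, l, hκl, hκ, hl⟩ := exists_ne_notMem hs
  have symm (i j) (hi : i ∉ s) (hj : j ∉ s) (hij : i ≠ j) : a i j - b i j = a j i - b j i := by
    grind [hab i j hi hj hij]
  have mem (i) : a i - b i ∈ rowSpace i := (rowSpace i).sub_mem (ha i) (hb i)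
  obtain ⟨z, hz, hzκ, hzl⟩ := exists_mem_cycleSpace_of_rows hκl (mem κ) (mem l)
    (symm κ l hκ hl hκl)
  refine ⟨z, hz, fun m hm => ?_⟩
  obtain rfl | hκm := eq_or_ne κ m
  · exact hzκ
  obtain rfl | hlm := eq_or_ne l m
  · exact hzl
  exact row_eq_of_row_eq hz hκl hκm hlm (mem m) (by rw [hzκ]; exact symm κ m hκ hm hκm)
    (by rw [hzl]; exact symm l m hl hm hlm)

end Transports

end Colours

namespace ColexGraph

variable {V : Type*} (G : ColexGraph V)

theorem mem_component_self (s : Finset (Fin 4)) (v : V) : v ∈ G.component s v :=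
  Relation.ReflTransGen.refl

theorem nbr_mem_component {s : Finset (Fin 4)} {κ : Fin 4} (hκ : κ ∈ s) (v : V) :
    G.nbr κ v ∈ G.component s v := Relation.ReflTransGen.single ⟨κ, hκ, rfl⟩

theorem eq_of_mem_component {X : Type*} {s : Finset (Fin 4)} {F : V → X}
    (hF : ∀ κ ∈ s, ∀ v, F (G.nbr κ v) = F v) {v w : V} (h : w ∈ G.component s v) : F w = F v := by
  induction h with
  | refl => rfl
  | tail _ h ih =>
    obtain ⟨κ, hκ, rfl⟩ := h
    rw [hF κ hκ, ih]

theorem component_nbr {s : Finset (Fin 4)} {κ : Fin 4} (hκ : κ ∈ s) (v : V) :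
    G.component s (G.nbr κ v) = G.component s v :=
  Set.Subset.antisymm (fun _ h => Relation.ReflTransGen.head ⟨κ, hκ, rfl⟩ h)
    fun _ h => Relation.ReflTransGen.head ⟨κ, hκ, G.nbr_nbr κ v⟩ h

theorem component_eq {s : Finset (Fin 4)} {v w : V} (h : w ∈ G.component s v) :
    G.component s w = G.component s v :=
  G.eq_of_mem_component (F := G.component s) (fun _ hκ v => G.component_nbr hκ v) h

theorem mem_component_symm {s : Finset (Fin 4)} {v w : V} (h : w ∈ G.component s v) :
    v ∈ G.component s w :=
  G.component_eq h ▸ G.mem_component_self s v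

theorem component_mono {s t : Finset (Fin 4)} (h : s ⊆ t) (v : V) :
    G.component s v ⊆ G.component t v := fun _ hw =>
  Relation.ReflTransGen.mono (fun _ _ ⟨κ, hκ, e⟩ => ⟨κ, h hκ, e⟩) _ _ hw

theorem component_empty (v : V) : G.component ∅ v = {v} :=
  Set.Subset.antisymm (fun _ h => G.eq_of_mem_component (F := id) (by simp) h)
    (Set.singleton_subset_iff.2 (G.mem_component_self ∅ v))

theorem component_singleton (κ : Fin 4) (v : V) : G.component {κ} v = {v, G.nbr κ v} := by
  refine Set.Subset.antisymm (fun w h => ?_) ?_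
  · induction h with
    | refl => exact .inl rfl
    | tail _ h ih =>
      obtain ⟨l, hl, rfl⟩ := h
      obtain rfl := Finset.mem_singleton.1 hl
      obtain rfl | rfl := ih
      · exact .inr rfl
      · exact .inl (G.nbr_nbr l v)
  · rintro _ (rfl | rfl)
    exacts [G.mem_component_self _ _, G.nbr_mem_component (Finset.mem_singleton_self κ) _]

variable {G}

theorem even_card_of_nbr_mem {κ : Fin 4} {P : Finset V} (hP : ∀ v ∈ P, G.nbr κ v ∈ P) :
    Even P.card := by
  rw [← ZMod.natCast_eq_zero_iff_even, Finset.card_eq_sum_ones, Nat.cast_sum, Nat.cast_one]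
  exact Finset.sum_involution (fun v _ => G.nbr κ v) (fun _ _ => by decide)
    (fun v _ _ => G.nbr_ne κ v) hP (fun v _ => G.nbr_nbr κ v)

/-- Otherwise the vertices other than `out` with the value of the first neighbour are paired by the
edges of colour `b`, and those of colour `a` pair them together with `out`. -/
theorem eq_nbr_out [Finite V] {X : Type*} {F : V → X} {a b : Fin 4}
    (ha : ∀ v, v ≠ G.out → G.nbr a v ≠ G.out → F (G.nbr a v) = F v)
    (hb : ∀ v, v ≠ G.out → G.nbr b v ≠ G.out → F (G.nbr b v) = F v) :
    F (G.nbr a G.out) = F (G.nbr b G.out) := by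
  classical
  have := Fintype.ofFinite V
  by_contra hne
  let P : Finset V := {v | v ≠ G.out ∧ F v = F (G.nbr a G.out)}
  have mem_P (v : V) : v ∈ P ↔ v ≠ G.out ∧ F v = F (G.nbr a G.out) := by simp [P]
  have even_P : Even P.card := even_card_of_nbr_mem (G := G) (κ := b) fun v hv => by
    rw [mem_P] at hv ⊢
    have hvb : G.nbr b v ≠ G.out := fun h => hne <| by rw [← h, G.nbr_nbr, h, hv.2]
    exact ⟨hvb, by rw [hb v hv.1 hvb, hv.2]⟩
  have even_insert : Even (insert G.out P).card :=
    even_card_of_nbr_mem (G := G) (κ := a) fun v hv => by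
      rw [Finset.mem_insert, mem_P] at hv ⊢
      by_cases hva : G.nbr a v = G.out
      · exact .inl hva
      refine .inr ⟨hva, ?_⟩
      obtain rfl | hv := hv
      · rfl
      · rw [ha v hv.1 hva, hv.2]
  rw [Finset.card_insert_of_notMem (by simp [P])] at even_insert
  exact Nat.not_even_iff_odd.2 even_P.add_one even_insert

theorem Elem.eq_component (x : G.Elem) {v : V} (hv : v ∈ x.1.2) :
    x.1.2 = G.component x.1.1 v := by
  obtain ⟨w, hw⟩ := x.2.2.1
  rw [hw] at hv ⊢
  exact (G.component_eq hv).symm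

theorem Elem.nonempty (x : G.Elem) : x.1.2.Nonempty := by
  obtain ⟨w, hw⟩ := x.2.2.1
  exact ⟨w, hw ▸ G.mem_component_self _ _⟩

theorem Elem.ne_out (x : G.Elem) {v : V} (hv : v ∈ x.1.2) : v ≠ G.out := fun h =>
  x.2.2.2 (h ▸ hv)

theorem Elem.ext_of_mem {x y : G.Elem} (h : x.1.1 = y.1.1) {v : V} (hx : v ∈ x.1.2)
    (hy : v ∈ y.1.2) : x = y :=
  Subtype.ext <| Prod.ext h <| by rw [x.eq_component hx, y.eq_component hy, h]

theorem Elem.eq_of_le_of_card {x y : G.Elem} (h : x ≤ y) (hc : y.1.1.card ≤ x.1.1.card) :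
    x = y := by
  obtain ⟨v, hv⟩ := x.nonempty
  exact Elem.ext_of_mem (Finset.eq_of_subset_of_card_le h.1 hc) hv (h.2 hv)

theorem Elem.card_lt_of_lt {x y : G.Elem} (h : x < y) : x.1.1.card < y.1.1.card :=
  not_le.1 fun hc => h.ne (Elem.eq_of_le_of_card h.le hc)

theorem Elem.le_iff_of_mem {x y : G.Elem} {v : V} (hx : v ∈ x.1.2) (hy : v ∈ y.1.2) :
    x ≤ y ↔ x.1.1 ⊆ y.1.1 := by
  refine ⟨fun h => h.1, fun h => ⟨h, ?_⟩⟩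
  rw [x.eq_component hx, y.eq_component hy]
  exact G.component_mono h v

theorem Elem.isMax_of_card_eq_three {x : G.Elem} (hx : x.1.1.card = 3) : IsMax x := fun y hxy =>
  (Elem.eq_of_le_of_card hxy (y.2.1.trans hx.ge)).ge

variable (G)

/-- The element with colours `s` that contains `v`. -/
def elem (s : Finset (Fin 4)) (v : V) (hs : s.card ≤ 3) (hv : G.out ∉ G.component s v) : G.Elem :=
  ⟨(s, G.component s v), hs, ⟨v, rfl⟩, hv⟩

open Classical in
/-- The value at the face with colours `s` through `v` of a function on the faces, zero if that
face contains `out`. -/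
noncomputable def faceValue (τ : G.Face → ZMod 2) (s : Finset (Fin 4)) (v : V) : ZMod 2 :=
  if h : s.card = 2 ∧ G.out ∉ G.component s v then
    τ ⟨G.elem s v (by omega) h.2, h.1⟩ else 0

variable {G}

theorem faceValue_of_mem (τ : G.Face → ZMod 2) (f : G.Face) {v : V} (hv : v ∈ G.verts f) :
    G.faceValue τ f.1.1.1 v = τ f := by
  have hf := f.1.eq_component hv
  rw [faceValue, dif_pos ⟨f.2, hf ▸ f.1.2.2.2⟩]
  exact congrArg τ (Subtype.ext (Subtype.ext (Prod.ext rfl hf.symm)))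

theorem faceValue_congr (τ : G.Face → ZMod 2) {s : Finset (Fin 4)} {v w : V}
    (h : w ∈ G.component s v) : G.faceValue τ s w = G.faceValue τ s v := by
  classical
  unfold faceValue
  exact dite_congr (by rw [G.component_eq h])
    (fun _ => congrArg τ (Subtype.ext (Subtype.ext (Prod.ext rfl (G.component_eq h)))))
    fun _ => rfl

theorem faceValue_eq_zero (τ : G.Face → ZMod 2) {s : Finset (Fin 4)} {v : V}
    (h : G.out ∈ G.component s v) : G.faceValue τ s v = 0 :=
  dif_neg fun hs => hs.2 h

/-- A family of rows, one for every cell of the closed colex, that vanishes on the cells that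
contain `out`: `α κ v` is the row of the `κ`-cell through `v`. -/
structure IsPotential (G : ColexGraph V) (α : Fin 4 → V → Fin 4 → ZMod 2) : Prop where
  mem_rowSpace : ∀ κ v, α κ v ∈ rowSpace κ
  nbr : ∀ κ l v, l ≠ κ → α κ (G.nbr l v) = α κ v
  out : ∀ κ, α κ G.out = 0

/-- `τ` is the coboundary of the potential `α`: its value at a face is the sum of the values at
the two cells that contain the face. The cells have the two colours missing in the edges of the
face. -/
structure IsCoboundary (G : ColexGraph V) (α : Fin 4 → V → Fin 4 → ZMod 2) (τ : G.Face → ZMod 2) :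
    Prop extends G.IsPotential α where
  faceValue_eq : ∀ κ l, κ ≠ l → ∀ v, G.faceValue τ {κ, l}ᶜ v = α κ v l + α l v κ

/-- The rows `a`, one for each of the four cells at `v`, have `τ` as coboundary at the vertex
`v`. -/
structure IsCoboundaryAt (G : ColexGraph V) (a : Fin 4 → Fin 4 → ZMod 2) (τ : G.Face → ZMod 2)
    (v : V) : Prop where
  mem_rowSpace : ∀ κ, a κ ∈ rowSpace κ
  faceValue_eq : ∀ κ l, κ ≠ l → G.faceValue τ {κ, l}ᶜ v = a κ l + a l κ

theorem exists_isCoboundaryAt {τ : G.Face → ZMod 2} {v : V}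
    (hτ : ∑ s ∈ Finset.powersetCard 2 Finset.univ, G.faceValue τ s v = 0) :
    ∃ a, G.IsCoboundaryAt a τ v := by
  obtain ⟨a, mem, add⟩ := exists_rows_of_sum_eq_zero hτ
  exact ⟨a, mem, fun κ l hκl => (add κ l hκl).symm⟩

theorem IsCoboundaryAt.add {a z : Fin 4 → Fin 4 → ZMod 2} {τ : G.Face → ZMod 2} {v : V}
    (ha : G.IsCoboundaryAt a τ v) (hz : z ∈ cycleSpace) : G.IsCoboundaryAt (a + z) τ v := by
  refine ⟨fun κ => (rowSpace κ).add_mem (ha.1 κ) (hz.2 κ), fun κ l hκl => ?_⟩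
  simp only [Pi.add_apply]
  rw [ha.2 κ l hκl, hz.1 l κ, add_add_add_comm, CharTwo.add_self_eq_zero, add_zero]

theorem IsCoboundaryAt.exists_transports {a b : Fin 4 → Fin 4 → ZMod 2} {τ : G.Face → ZMod 2}
    {s : Finset (Fin 4)} {v w : V} (ha : G.IsCoboundaryAt a τ v) (hb : G.IsCoboundaryAt b τ w)
    (hs : s.card ≤ 2) (hw : w ∈ G.component s v) : ∃ z, Transports s a b z := by
  refine Transports.exists_of_add_eq hs ha.1 hb.1 fun κ l hκ hl hκl => ?_
  rw [← ha.2 κ l hκl, ← hb.2 κ l hκl]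
  exact (faceValue_congr τ (G.component_mono (Finset.subset_compl_comm.1 <| by
    simp [Finset.insert_subset_iff, hκ, hl]) v hw)).symm

theorem orderAcyclic_two_skeleton {A : Type*} [AddCommGroup A]
    (hcell : ∀ c : G.Cell, OrderAcyclic (Set.Iio c.1) A)
    (hall : OrderAcyclic (Set.univ : Set G.Elem) A) :
    OrderAcyclic {x : G.Elem | x.1.1.card = 3}ᶜ A :=
  OrderAcyclic.compl_of_isMax (fun _ hx => Elem.isMax_of_card_eq_three hx)
    (fun x hx => hcell ⟨x, hx⟩) hall

/-- The cycles that transport the rows between the base points of incident elements form a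
cocycle on the 2-skeleton, since cycles are determined by two of their rows. Its primitive corrects
the rows at the vertices. -/
theorem exists_rows_add_eq {a : V → Fin 4 → Fin 4 → ZMod 2} {τ : G.Face → ZMod 2}
    (hacyclic : OrderAcyclic {x : G.Elem | x.1.1.card = 3}ᶜ cycleSpace)
    (ha : ∀ v, v ≠ G.out → G.IsCoboundaryAt (a v) τ v) :
    ∃ (z : V → cycleSpace) (b : G.Elem → Fin 4 → Fin 4 → ZMod 2), ∀ (x : G.Elem) (v : V),
      x.1.1.card ≤ 2 → v ∈ x.1.2 → ∀ κ ∉ x.1.1, (a v + z v) κ = b x κ := by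
  choose r hr using fun x : G.Elem => x.nonempty
  have exists_h (x y : G.Elem) : ∃ h : cycleSpace, y.1.1.card ≤ 2 → x ≤ y →
      Transports y.1.1 (a (r x)) (a (r y)) h := by
    by_cases hxy : y.1.1.card ≤ 2 ∧ x ≤ y
    · obtain ⟨z, hz⟩ := (ha _ (x.ne_out (hr x))).exists_transports (ha _ (y.ne_out (hr y)))
        hxy.1 (y.eq_component (hxy.2.2 (hr x)) ▸ hr y)
      exact ⟨⟨z, hz.1⟩, fun _ _ => hz⟩
    · exact ⟨0, fun h₁ h₂ => absurd ⟨h₁, h₂⟩ hxy⟩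
  choose h hh using exists_h
  have card_le {x : G.Elem} (hx : x ∈ {x : G.Elem | x.1.1.card = 3}ᶜ) : x.1.1.card ≤ 2 :=
    Nat.le_of_lt_succ (x.2.1.lt_of_ne hx)
  have notMem {x : G.Elem} (hx : x.1.1.card ≤ 2) : x ∈ {x : G.Elem | x.1.1.card = 3}ᶜ :=
    (Nat.lt_succ_of_le hx).ne
  obtain ⟨g, hg⟩ := hacyclic h fun x _ y hy w hw hxy hyw => Subtype.ext <|
    (hh x w (card_le hw) (hxy.trans hyw)).unique (card_le hw) <|
      ((hh x y (card_le hy) hxy).mono hyw.1).add (hh y w (card_le hw) hyw)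
  have exists_z (v : V) : ∃ z : cycleSpace, ∀ x : G.Elem, x.1.1.card ≤ 2 → v ∈ x.1.2 →
      ∀ κ ∉ x.1.1, (a v + z) κ = (a (r x) + g x) κ := by
    by_cases hv : v = G.out
    · exact ⟨0, fun x _ hx => absurd hv (x.ne_out hx)⟩
    let y := G.elem ∅ v (by simp) (by rw [component_empty]; exact fun e => hv e.symm)
    have hry : r y = v := by simpa only [y, elem, component_empty, Set.mem_singleton_iff] using hr y
    refine ⟨g y, fun x hx hvx κ hκ => ?_⟩
    have hyx : y ≤ x := (Elem.le_iff_of_mem (G.mem_component_self ∅ v) hvx).2 (by simp [y, elem])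
    have transport := (hh y x hx hyx).2 κ hκ
    rw [hg y (notMem (by simp [y, elem])) x (notMem hx) hyx, hry] at transport
    exact (sub_eq_sub_iff_add_eq_add.1 transport.symm).trans (add_comm _ _)
  choose z hz using exists_z
  exact ⟨z, fun x => a (r x) + g x, fun x v => hz v x⟩

/-- The rows that are obtained at the neighbours of `out` form a cycle. Subtracting it everywhere
makes the rows vanish at `out`. -/
theorem exists_isCoboundary_of_nbr [Finite V] {a : V → Fin 4 → Fin 4 → ZMod 2}
    {τ : G.Face → ZMod 2} (ha : ∀ v, v ≠ G.out → G.IsCoboundaryAt (a v) τ v)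
    (hnbr : ∀ κ l v, l ≠ κ → v ≠ G.out → G.nbr l v ≠ G.out → a (G.nbr l v) κ = a v κ) :
    ∃ α, G.IsCoboundary α τ := by
  classical
  choose m hm _ using fun κ => exists_ne_ne κ κ
  let o (κ : Fin 4) : Fin 4 → ZMod 2 := a (G.nbr (m κ) G.out) κ
  have ho (κ l) (hl : l ≠ κ) : a (G.nbr l G.out) κ = o κ :=
    eq_nbr_out (F := fun v => a v κ) (hnbr κ l · hl) (hnbr κ (m κ) · (hm κ))
  have o_mem : o ∈ cycleSpace := by
    refine ⟨fun κ l => ?_, fun κ => (ha _ (G.nbr_ne _ _)).1 κ⟩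
    obtain rfl | hκl := eq_or_ne κ l
    · rfl
    obtain ⟨i, hiκ, hil⟩ := exists_ne_ne κ l
    rw [← ho κ i hiκ, ← ho l i hil, ← CharTwo.add_eq_zero, ← (ha _ (G.nbr_ne i _)).2 κ l hκl]
    exact faceValue_eq_zero τ (G.mem_component_symm (G.nbr_mem_component (by simp [hiκ, hil]) _))
  let α (κ : Fin 4) (v : V) : Fin 4 → ZMod 2 := if v = G.out then 0 else (a v + o) κ
  have α_out (κ) : α κ G.out = 0 := if_pos rfl
  have α_of_ne (κ) {v} (hv : v ≠ G.out) : α κ v = (a v + o) κ := if_neg hv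
  have α_nbr_out (κ l) (hl : l ≠ κ) : α κ (G.nbr l G.out) = 0 := by
    rw [α_of_ne κ (G.nbr_ne l _), Pi.add_apply, ho κ l hl]
    exact funext fun i => CharTwo.add_self_eq_zero _
  refine ⟨α, ⟨fun κ v => ?_, fun κ l v hl => ?_, α_out⟩, fun κ l hκl v => ?_⟩ <;>
    obtain rfl | hv := eq_or_ne v G.out
  · exact α_out κ ▸ (rowSpace κ).zero_mem
  · exact α_of_ne κ hv ▸ ((ha v hv).add o_mem).1 κ
  · rw [α_out, α_nbr_out κ l hl]
  · obtain hn | hn := eq_or_ne (G.nbr l v) G.out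
    · rw [hn, α_out, ← G.nbr_nbr l v, hn, α_nbr_out κ l hl]
    · rw [α_of_ne κ hn, α_of_ne κ hv, Pi.add_apply, Pi.add_apply, hnbr κ l v hl hv hn]
  · rw [α_out, α_out, faceValue_eq_zero τ (G.mem_component_self _ _)]
    rfl
  · rw [α_of_ne κ hv, α_of_ne l hv, ← ((ha v hv).add o_mem).2 κ l hκl]

theorem exists_isCoboundary [Finite V]
    (hcell : ∀ c : G.Cell, OrderAcyclic (Set.Iio c.1) cycleSpace)
    (hall : OrderAcyclic (Set.univ : Set G.Elem) cycleSpace) {τ : G.Face → ZMod 2}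
    (hτ : ∀ v, v ≠ G.out → ∑ s ∈ Finset.powersetCard 2 Finset.univ, G.faceValue τ s v = 0) :
    ∃ α, G.IsCoboundary α τ := by
  choose! a ha using fun v hv => exists_isCoboundaryAt (hτ v hv)
  obtain ⟨z, b, hz⟩ := exists_rows_add_eq (orderAcyclic_two_skeleton hcell hall) ha
  refine exists_isCoboundary_of_nbr (fun v hv => (ha v hv).add (z v).2)
    fun κ l v hl hv hn => ?_
  have out_notMem : G.out ∉ G.component {l} v := by
    rw [component_singleton]
    rintro (h | h)
    exacts [hv h.symm, hn h.symm]
  have eq_edge {w : V} (hw : w ∈ G.component {l} v) := hz (G.elem {l} v (by simp) out_notMem) w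
    (by simp [elem]) hw κ (by simpa [elem] using hl.symm)
  rw [eq_edge (G.nbr_mem_component (Finset.mem_singleton_self l) v),
    eq_edge (G.mem_component_self _ v)]

end ColexGraph

theorem mem_of_forall_dotProduct_eq_zero {K F : Type*} [Field K] [Fintype F]
    {W : Submodule K (F → K)} {y : F → K}
    (hy : ∀ τ : F → K, (∀ w ∈ W, τ ⬝ᵥ w = 0) → τ ⬝ᵥ y = 0) : y ∈ W := by
  classical
  by_contra hyW
  obtain ⟨ψ, hψ, hle⟩ := Submodule.exists_le_ker_of_notMem hyW
  have ψ_eq (w : F → K) : ψ w = (fun f => ψ (Pi.single f 1)) ⬝ᵥ w := by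
    conv_lhs => rw [pi_eq_sum_univ' w]
    simp [dotProduct, mul_comm]
  exact hψ <| (ψ_eq y).trans <| hy _ fun w hw => (ψ_eq w).symm.trans (hle hw)

theorem sum_ite_mem_mul_eq_ncard {V : Type*} [Fintype V] (A : Set V) [DecidablePred (· ∈ A)]
    (q : V → ZMod 2) :
    ∑ v, (if v ∈ A then 1 else 0) * q v = ((A ∩ {v | q v = 1}).ncard : ZMod 2) := by
  have eq_coe : A ∩ {v | q v = 1} = ({v | v ∈ A ∧ q v = 1} : Finset V) := by
    ext v
    simp
  rw [eq_coe, Set.ncard_coe_finset, Finset.card_filter, Nat.cast_sum]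
  refine Finset.sum_congr rfl fun v _ => ?_
  generalize q v = a
  by_cases hv : v ∈ A <;> simp only [hv, true_and, false_and, if_true, if_false] <;>
    revert a <;> decide

theorem ColexGraph.sum_faceValue {V : Type*} {G : ColexGraph V} [Fintype G.Face]
    (τ : G.Face → ZMod 2) (v : V) [∀ f : G.Face, Decidable (v ∈ G.verts f)] :
    ∑ s ∈ Finset.powersetCard 2 Finset.univ, G.faceValue τ s v =
      ∑ f, τ f * (if v ∈ G.verts f then 1 else 0) := by
  simp only [mul_ite, mul_one, mul_zero]
  rw [← Finset.sum_filter, ← Finset.sum_fiberwise_of_maps_to (g := fun f : G.Face => f.1.1.1)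
    (t := Finset.powersetCard 2 Finset.univ) (fun f _ => by simp [f.2])]
  refine Finset.sum_congr rfl fun s hs => ?_
  have card_s : s.card = 2 := (Finset.mem_powersetCard.1 hs).2
  simp only [Finset.filter_filter]
  by_cases hout : G.out ∈ G.component s v
  · rw [faceValue_eq_zero τ hout, Finset.sum_eq_zero]
    intro f hf
    obtain ⟨hvf, rfl⟩ := (Finset.mem_filter.1 hf).2
    exact absurd (f.1.eq_component hvf ▸ hout) f.1.2.2.2
  · let g : G.Face := ⟨G.elem s v (by omega) hout, card_s⟩
    have hvg : v ∈ G.verts g := G.mem_component_self s v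
    have eq_singleton : ({f | v ∈ G.verts f ∧ f.1.1.1 = s} : Finset G.Face) = {g} := by
      ext f
      rw [Finset.mem_filter_univ, Finset.mem_singleton]
      exact ⟨fun hf => Subtype.ext (Elem.ext_of_mem hf.2 hf.1 hvg), fun hf => hf ▸ ⟨hvg, rfl⟩⟩
    rw [eq_singleton, Finset.sum_singleton]
    exact faceValue_of_mem τ g hvg

namespace TetrahedralColex

variable {V : Type*} (T : TetrahedralColex V)

theorem exists_isCoboundary {τ : T.Face → ZMod 2} (hτ : ∀ v, v ≠ T.out →
    ∑ s ∈ Finset.powersetCard 2 Finset.univ, T.faceValue τ s v = 0) :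
    ∃ α, T.IsCoboundary α τ := by
  have := T.finite
  exact ColexGraph.exists_isCoboundary
    (fun c => .of_homeomorph_sphere (by simp) (T.cell_boundary c).some _)
    (.of_homeomorph_closedBall T.ball.some _) hτ

theorem exists_symmDiff_mem_syndromes {M : Set T.Face} {φ : Finset T.Face}
    (hφ : ∀ α τ, T.IsCoboundary α τ → (∀ f ∈ M, τ f = 0) → ∑ f ∈ φ, τ f = 0) :
    ∃ φ' ⊆ M, (φ : Set T.Face) ∆ φ' ∈ T.syndromes := by
  classical
  have := T.finite
  have := Fintype.ofFinite V
  have := Fintype.ofFinite T.Face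
  let A : Matrix T.Face V (ZMod 2) := .of fun f v => if v ∈ T.verts f then 1 else 0
  have mem_sup : (fun f => if f ∈ φ then 1 else 0) ∈
      A.mulVecLin.range ⊔ Submodule.pi Mᶜ (fun _ => (⊥ : Submodule (ZMod 2) (ZMod 2))) := by
    refine mem_of_forall_dotProduct_eq_zero fun τ hτ => ?_
    obtain ⟨α, hα⟩ := T.exists_isCoboundary (τ := τ) fun v _ => by
      rw [ColexGraph.sum_faceValue]
      simpa [A, dotProduct] using hτ _ (Submodule.mem_sup_left ⟨Pi.single v 1, rfl⟩)
    have hM (f) (hf : f ∈ M) : τ f = 0 := by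
      simpa using hτ (Pi.single f 1) <| Submodule.mem_sup_right fun g hg =>
        Pi.single_eq_of_ne (fun h : g = f => hg (h ▸ hf)) 1
    simpa [dotProduct] using hφ α τ hα hM
  obtain ⟨_, ⟨q, rfl⟩, b, hb, sum_eq⟩ := Submodule.mem_sup.1 mem_sup
  let S : Set T.Face := {f | Odd (T.verts f ∩ {v | v ≠ T.out ∧ q v = 1}).ncard}
  have mem_S (f : T.Face) : f ∈ S ↔ A.mulVecLin q f = 1 := by
    have inter_eq : T.verts f ∩ {v | v ≠ T.out ∧ q v = 1} = T.verts f ∩ {v | q v = 1} :=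
      Set.ext fun v => and_congr_right fun hv => and_iff_right (f.1.ne_out hv)
    change Odd _ ↔ _
    rw [inter_eq, ← ZMod.natCast_eq_one_iff_odd, ← sum_ite_mem_mul_eq_ncard]
    rfl
  refine ⟨φ ∆ S, fun f hf => by_contra fun hfM => ?_, ?_⟩
  · have eq_ite : A.mulVecLin q f = if f ∈ φ then 1 else 0 := by
      rw [← congrFun sum_eq f, Pi.add_apply, (Submodule.mem_bot (ZMod 2)).1 (hb f hfM), add_zero]
    rw [Set.mem_symmDiff, mem_S, eq_ite, Finset.mem_coe] at hf
    by_cases hfφ : f ∈ φ <;> simp [hfφ] at hf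
  · rw [symmDiff_symmDiff_cancel_left]
    exact ⟨_, fun h => h.1 rfl, rfl⟩

end TetrahedralColex

theorem exists_sum_eq_single_add_single {ι X : Type*} [Fintype ι] [DecidableEq X]
    {r : ι → X → X} (hr : ∀ i, Function.Involutive (r i)) {x y : X}
    (hxy : Relation.ReflTransGen (fun x y => ∃ i, r i x = y) x y) :
    ∃ h : ι → X → ZMod 2, (∀ i z, h i (r i z) = h i z) ∧
      ∑ i, h i = Pi.single x 1 + Pi.single y 1 := by
  classical
  induction hxy with
  | refl => exact ⟨0, fun _ _ => rfl, funext fun z => by simp [CharTwo.add_self_eq_zero]⟩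
  | @tail y _ _ hy ih =>
    obtain ⟨i, rfl⟩ := hy
    obtain ⟨h, h_inv, h_sum⟩ := ih
    let p : X → ZMod 2 := Pi.single y 1 + Pi.single (r i y) 1
    have p_inv (z : X) : p (r i z) = p z := by
      simp only [p, Pi.add_apply, Pi.single_apply, (hr i).injective.eq_iff, (hr i).eq_iff, add_comm]
    refine ⟨h + Pi.single i p, fun j z => ?_, ?_⟩
    · obtain rfl | hji := eq_or_ne j i
      · simp [h_inv, p_inv]
      · simp [h_inv, hji]
    · simp only [Pi.add_apply, Finset.sum_add_distrib, Finset.sum_pi_single', Finset.mem_univ,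
        if_true, h_sum]
      exact funext fun z => by simp [p, add_assoc, CharTwo.add_cancel_left]

namespace ColexGraph

variable {V : Type*} {G : ColexGraph V} {c : G.Cell}

theorem Elem.nbr_mem (x : G.Elem) {v : V} (hv : v ∈ x.1.2) {a : Fin 4} (ha : a ∈ x.1.1) :
    G.nbr a v ∈ x.1.2 := by
  rw [x.eq_component hv]
  exact G.nbr_mem_component ha v

/-- A flag of the cell `c`, that is, a vertex, an edge and a face of `c`, each contained in the
next one. It is encoded by the vertex `v` and an ordering `a, b, d` of the colours of `c`: the edge
has the colour `a` and the face has the colours `a` and `b`. -/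
@[ext]
structure Flag (c : G.Cell) where
  v : V
  a : Fin 4
  b : Fin 4
  d : Fin 4
  mem : v ∈ c.1.1.2
  colors_eq : {a, b, d} = c.1.1.1

namespace Flag

instance [Finite V] : Finite (Flag c) :=
  Finite.of_injective (fun x : Flag c => (x.v, x.a, x.b, x.d)) fun x y h => by
    simp only [Prod.mk.injEq] at h
    exact Flag.ext h.1 h.2.1 h.2.2.1 h.2.2.2

/-- The colours of the vertex, the edge and the face of a flag. -/
def colors (x : Flag c) : Fin 3 → Finset (Fin 4) := ![∅, {x.a}, {x.a, x.b}]

theorem distinct (x : Flag c) : x.a ≠ x.b ∧ x.a ≠ x.d ∧ x.b ≠ x.d := by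
  have card_eq := c.2
  rw [← x.colors_eq] at card_eq
  generalize x.a = a, x.b = b, x.d = d at *
  revert a b d
  decide

theorem colors_subset (x : Flag c) (j : Fin 3) : x.colors j ⊆ c.1.1.1 := by
  rw [← x.colors_eq]
  fin_cases j <;> simp [colors, Finset.insert_subset_iff]

theorem card_colors (x : Flag c) (j : Fin 3) : (x.colors j).card = j := by
  fin_cases j <;> simp [colors, Finset.card_pair x.distinct.1]

theorem component_subset (x : Flag c) (j : Fin 3) : G.component (x.colors j) x.v ⊆ c.1.1.2 :=
  c.1.eq_component x.mem ▸ G.component_mono (x.colors_subset j) x.v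

/-- The vertex, the edge and the face of a flag. -/
def elem (x : Flag c) (j : Fin 3) : G.Elem :=
  G.elem (x.colors j) x.v (x.card_colors j ▸ by omega) fun h => c.1.2.2.2 (x.component_subset j h)

theorem card_elem (x : Flag c) (j : Fin 3) : (x.elem j).1.1.card = j := x.card_colors j

theorem v_mem_elem (x : Flag c) (j : Fin 3) : x.v ∈ (x.elem j).1.2 := G.mem_component_self _ _

theorem elem_injective {x y : Flag c} {i j : Fin 3} (h : x.elem i = y.elem j) : i = j :=
  Fin.ext <| by rw [← x.card_elem i, ← y.card_elem j, h]

theorem elem_mono (x : Flag c) : Monotone x.elem := fun i j hij =>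
  (Elem.le_iff_of_mem (x.v_mem_elem i) (x.v_mem_elem j)).2 <| by
    change x.colors i ⊆ x.colors j
    revert hij
    fin_cases i <;> fin_cases j <;> simp [colors]

/-- The flag that differs from `x` in the element of dimension `i` only. -/
def adj (i : Fin 3) (x : Flag c) : Flag c :=
  match i with
  | 0 => ⟨G.nbr x.a x.v, x.a, x.b, x.d,
      c.1.nbr_mem x.mem (x.colors_eq ▸ Finset.mem_insert_self _ _), x.colors_eq⟩
  | 1 => ⟨x.v, x.b, x.a, x.d, x.mem, (Finset.insert_comm x.b x.a {x.d}).trans x.colors_eq⟩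
  | 2 => ⟨x.v, x.a, x.d, x.b, x.mem,
      (congrArg (insert x.a) (Finset.pair_comm x.d x.b)).trans x.colors_eq⟩

theorem adj_involutive (i : Fin 3) : Function.Involutive (adj (c := c) i) := fun x => by
  fin_cases i <;> simp [adj, G.nbr_nbr]

theorem adj_ne (i : Fin 3) (x : Flag c) : x.adj i ≠ x := fun h => by
  fin_cases i
  · exact G.nbr_ne _ _ (congrArg v h)
  · exact x.distinct.1 (congrArg b h)
  · exact x.distinct.2.2 (congrArg d h)

theorem elem_adj {i j : Fin 3} (hij : j ≠ i) (x : Flag c) : (x.adj i).elem j = x.elem j := by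
  have colors_adj : (x.adj i).colors j = x.colors j := by
    fin_cases i <;> fin_cases j <;>
      first | exact absurd rfl hij | rfl | exact Finset.pair_comm x.b x.a
  refine Elem.ext_of_mem colors_adj (v := (x.adj i).v) (v_mem_elem _ j) ?_
  fin_cases i
  · refine (x.elem j).nbr_mem (x.v_mem_elem j) ?_
    change x.a ∈ x.colors j
    fin_cases j <;> first | exact absurd rfl hij | simp [colors]
  · exact x.v_mem_elem j
  · exact x.v_mem_elem j

theorem eq_or_eq_adj_two {x y : Flag c} (hv : y.v = x.v) (ha : y.a = x.a) :
    y = x ∨ y = x.adj 2 := by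
  have colors_eq : ({y.a, y.b, y.d} : Finset (Fin 4)) = {x.a, x.b, x.d} :=
    y.colors_eq.trans x.colors_eq.symm
  have distinct := y.distinct
  have hb : y.b ∈ ({x.a, x.b, x.d} : Finset (Fin 4)) := by simp [← colors_eq]
  have hd : y.d ∈ ({x.a, x.b, x.d} : Finset (Fin 4)) := by simp [← colors_eq]
  simp only [Finset.mem_insert, Finset.mem_singleton, ← ha, distinct.1.symm, distinct.2.1.symm,
    false_or] at hb hd
  obtain hb | hb := hb
  · exact .inl (Flag.ext hv ha hb (hd.resolve_left fun h => distinct.2.2 (hb.trans h.symm)))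
  · exact .inr (Flag.ext hv ha hb (hd.resolve_right fun h => distinct.2.2 (hb.trans h.symm)))

theorem eq_of_colors_two_eq {x y : Flag c} (hv : y.v = x.v) (ha : y.a = x.a)
    (h : y.colors 2 = x.colors 2) : y = x := by
  refine (eq_or_eq_adj_two hv ha).resolve_right fun hy => ?_
  have d_mem : x.d ∈ x.colors 2 := by
    rw [← h, hy]
    exact Finset.mem_insert_of_mem (Finset.mem_singleton_self _)
  simp [colors, x.distinct.2.1.symm, x.distinct.2.2.symm] at d_mem

theorem eq_or_eq_adj {i : Fin 3} {x y : Flag c} (h : ∀ j, j ≠ i → y.elem j = x.elem j) :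
    y = x ∨ y = x.adj i := by
  have colors_eq {j} (hj : j ≠ i) : y.colors j = x.colors j := congrArg (·.1.1) (h j hj)
  have v_mem {j} (hj : j ≠ i) : y.v ∈ G.component (x.colors j) x.v :=
    (congrArg (y.v ∈ ·.1.2) (h j hj)).mp (y.v_mem_elem j)
  have v_eq (hi : 0 ≠ i) : y.v = x.v := by
    simpa [colors, component_empty] using v_mem hi
  have a_eq (hi : 1 ≠ i) : y.a = x.a := Finset.singleton_injective (colors_eq hi)
  match i with
  | 0 =>
    have colors_two : y.colors 2 = x.colors 2 := colors_eq (by decide)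
    have v_mem_edge : y.v ∈ G.component {x.a} x.v := v_mem (j := 1) (by decide)
    rw [component_singleton] at v_mem_edge
    exact v_mem_edge.imp (eq_of_colors_two_eq · (a_eq (by decide)) colors_two)
      (eq_of_colors_two_eq (x := x.adj 0) · (a_eq (by decide)) colors_two)
  | 1 =>
    have colors_two : y.colors 2 = x.colors 2 := colors_eq (by decide)
    have a_mem : y.a ∈ x.colors 2 := colors_two ▸ Finset.mem_insert_self _ _
    obtain ha | ha := Finset.mem_insert.1 a_mem
    · exact .inl (eq_of_colors_two_eq (v_eq (by decide)) ha colors_two)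
    · exact .inr (eq_of_colors_two_eq (x := x.adj 1) (v_eq (by decide)) (Finset.mem_singleton.1 ha)
        (colors_two.trans (Finset.pair_comm _ _)))
  | 2 => exact eq_or_eq_adj_two (v_eq (by decide)) (a_eq (by decide))

theorem exists_v_eq_a_eq_colors_two_eq {v : V} (hv : v ∈ c.1.1.2) {t : Finset (Fin 4)}
    (ht : t ⊆ c.1.1.1) (card_t : t.card = 2) {a : Fin 4} (ha : a ∈ t) :
    ∃ x : Flag c, x.v = v ∧ x.a = a ∧ x.colors 2 = t := by
  have exists_colors : ∀ s : Finset (Fin 4), s.card = 3 → ∀ t ⊆ s, t.card = 2 → ∀ a ∈ t,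
      ∃ b d, {a, b, d} = s ∧ {a, b} = t := by
    decide
  obtain ⟨b, d, hs, ht⟩ := exists_colors c.1.1.1 c.2 t ht card_t a ha
  exact ⟨⟨v, a, b, d, hv, hs⟩, rfl, rfl, ht⟩

theorem exists_elem_two_eq {f : G.Face} (hf : G.IsFaceOf f c) : ∃ x : Flag c, x.elem 2 = f.1 := by
  obtain ⟨a, ha⟩ := Finset.card_pos.1 (f.2 ▸ two_pos)
  obtain ⟨v, hv⟩ := f.1.nonempty
  obtain ⟨x, rfl, -, ht⟩ := exists_v_eq_a_eq_colors_two_eq (hf.2 hv) hf.1 f.2 ha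
  exact ⟨x, Elem.ext_of_mem ht (x.v_mem_elem 2) hv⟩

theorem exists_elem_eq {p q w : G.Elem} (hpq : p < q) (hqw : q < w) (hwc : w < c.1) :
    ∃ x : Flag c, x.elem 0 = p ∧ x.elem 1 = q ∧ x.elem 2 = w := by
  have := c.2
  have := Elem.card_lt_of_lt hpq
  have := Elem.card_lt_of_lt hqw
  have := Elem.card_lt_of_lt hwc
  obtain ⟨a, ha⟩ := Finset.card_eq_one.1 (show q.1.1.card = 1 by omega)
  obtain ⟨v, hv⟩ := p.nonempty
  obtain ⟨x, rfl, rfl, ht⟩ := exists_v_eq_a_eq_colors_two_eq ((hpq.trans (hqw.trans hwc)).le.2 hv)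
    hwc.le.1 (by omega) (hqw.le.1 (ha ▸ Finset.mem_singleton_self a))
  exact ⟨x, Elem.ext_of_mem (Finset.card_eq_zero.1 (by omega)).symm (x.v_mem_elem 0) hv,
    Elem.ext_of_mem ha.symm (x.v_mem_elem 1) (hpq.le.2 hv),
    Elem.ext_of_mem ht (x.v_mem_elem 2) (hqw.le.2 (hpq.le.2 hv))⟩

open Relation in
theorem reflTransGen_of_v_eq {x y : Flag c} (hv : y.v = x.v) :
    ReflTransGen (fun x y : Flag c => ∃ i, x.adj i = y) x y := by
  have of_a_eq {x y : Flag c} (hv : y.v = x.v) (ha : y.a = x.a) :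
      ReflTransGen (fun x y : Flag c => ∃ i, x.adj i = y) x y := by
    obtain rfl | rfl := eq_or_eq_adj_two hv ha
    exacts [.refl, .single ⟨2, rfl⟩]
  have a_mem : y.a ∈ ({x.a, x.b, x.d} : Finset (Fin 4)) := by
    rw [x.colors_eq, ← y.colors_eq]
    exact Finset.mem_insert_self _ _
  rw [Finset.mem_insert, Finset.mem_insert, Finset.mem_singleton] at a_mem
  obtain ha | ha | ha := a_mem
  · exact of_a_eq hv ha
  · exact .head ⟨1, rfl⟩ (of_a_eq (x := x.adj 1) hv ha)
  · exact .head ⟨2, rfl⟩ (.head ⟨1, rfl⟩ (of_a_eq (x := (x.adj 2).adj 1) hv ha))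

open Relation in
theorem reflTransGen_adj (x y : Flag c) :
    ReflTransGen (fun x y : Flag c => ∃ i, x.adj i = y) x y := by
  have v_mem : y.v ∈ G.component c.1.1.1 x.v := c.1.eq_component x.mem ▸ y.mem
  generalize hw : y.v = w at v_mem
  induction v_mem generalizing y with
  | refl => exact reflTransGen_of_v_eq hw
  | @tail u _ hu h ih =>
    obtain ⟨κ, hκ, rfl⟩ := h
    have u_mem : u ∈ c.1.1.2 := c.1.eq_component x.mem ▸ hu
    obtain ⟨t, hκt, ht, card_t⟩ := Finset.exists_subsuperset_card_eq
      (Finset.singleton_subset_iff.2 hκ) (n := 2) (by simp) (by rw [c.2]; norm_num)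
    obtain ⟨z, rfl, rfl, -⟩ := exists_v_eq_a_eq_colors_two_eq u_mem ht card_t
      (Finset.singleton_subset_iff.1 hκt)
    exact (ih z rfl).tail ⟨0, rfl⟩ |>.trans (reflTransGen_of_v_eq hw)

theorem exists_elem_elem_eq {A : Type*} [AddMonoid A] {h : Fin 3 → Flag c → A}
    (h_adj : ∀ i x, h i (x.adj i) = h i x) :
    ∃ H : G.Elem → G.Elem → A, (∀ p, H p p = 0) ∧
      ∀ (x : Flag c) (i j k : Fin 3), j < k → i ≠ j → i ≠ k → H (x.elem j) (x.elem k) = h i x := by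
  suffices exists_value : ∀ p q : G.Elem, ∃ e : A, (p = q → e = 0) ∧
      ∀ (x : Flag c) (i j k : Fin 3), j < k → i ≠ j → i ≠ k → x.elem j = p → x.elem k = q →
        e = h i x by
    choose H H_self H_elem using exists_value
    exact ⟨H, fun p => H_self p p rfl,
      fun x i j k hjk hij hik => H_elem _ _ x i j k hjk hij hik rfl rfl⟩
  intro p q
  by_cases hpq : ∃ (x : Flag c) (i j k : Fin 3),
    j < k ∧ i ≠ j ∧ i ≠ k ∧ x.elem j = p ∧ x.elem k = q
  · obtain ⟨x, i, j, k, hjk, hij, hik, rfl, rfl⟩ := hpq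
    refine ⟨h i x, fun h_eq => absurd (elem_injective h_eq) hjk.ne,
      fun y i' j' k' _ hij' hik' hj hk => ?_⟩
    obtain rfl : j' = j := elem_injective hj
    obtain rfl : k' = k := elem_injective hk
    obtain rfl : i' = i := by omega
    obtain rfl | rfl := eq_or_eq_adj (x := x) (y := y) (i := i') fun m hm => by
      obtain rfl | rfl : m = j' ∨ m = k' := by omega
      exacts [hj, hk]
    exacts [rfl, (h_adj _ _).symm]
  · exact ⟨0, fun _ => rfl, fun x i j k hjk hij hik hj hk =>
      absurd ⟨x, i, j, k, hjk, hij, hik, hj, hk⟩ hpq⟩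

theorem exists_primitive {S : Set G.Elem} (hS : OrderAcyclic S (ZMod 2))
    (S_lt : ∀ p ∈ S, p < c.1) {h : Fin 3 → Flag c → ZMod 2}
    (h_adj : ∀ i x, h i (x.adj i) = h i x) (h_sum : ∀ x, x.elem 2 ∈ S → ∑ i, h i x = 0) :
    ∃ g : G.Elem → ZMod 2, ∀ x : Flag c, x.elem 0 ∈ S → x.elem 1 ∈ S →
      h 2 x = g (x.elem 1) + g (x.elem 0) := by
  obtain ⟨H, H_self, H_elem⟩ := exists_elem_elem_eq h_adj
  obtain ⟨g, hg⟩ := hS H fun p _ q _ w hw hpq hqw => by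
    obtain rfl | hpq := hpq.eq_or_lt
    · rw [H_self, zero_add]
    obtain rfl | hqw := hqw.eq_or_lt
    · rw [H_self, add_zero]
    obtain ⟨x, rfl, rfl, rfl⟩ := exists_elem_eq hpq hqw (S_lt w hw)
    have sum_eq := h_sum x hw
    rw [Fin.sum_univ_three] at sum_eq
    rw [H_elem x 1 0 2 (by decide) (by decide) (by decide),
      H_elem x 2 0 1 (by decide) (by decide) (by decide),
      H_elem x 0 1 2 (by decide) (by decide) (by decide)]
    linear_combination sum_eq - CharTwo.add_self_eq_zero (h 0 x + h 2 x)
  refine ⟨g, fun x h0 h1 => ?_⟩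
  rw [← CharTwo.sub_eq_add, ← hg _ h0 _ h1 (x.elem_mono (by decide)),
    H_elem x 2 0 1 (by decide) (by decide) (by decide)]

theorem sum_eq_zero_of_adj [Fintype (Flag c)] (i : Fin 3) {F : Flag c → ZMod 2}
    (hF : ∀ x, F (x.adj i) = F x) : ∑ x, F x = 0 :=
  Finset.sum_involution (fun x _ => x.adj i) (fun x _ => by rw [hF, CharTwo.add_self_eq_zero])
    (fun x _ _ => x.adj_ne i) (fun _ _ => Finset.mem_univ _) fun x _ => adj_involutive i x

/-- A connected sum of 2-cochains `h i` supported on the two flags `x` and `y` is paired with `u`.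
On `S` the third cochain has a primitive, which makes all terms of the pairing other than `u x` and
`u y` invariant under one of the involutions. -/
theorem eq_of_adj_eq [Finite V] {S : Set G.Elem} (hS : OrderAcyclic S (ZMod 2))
    (S_lower : IsLowerSet S) (S_lt : ∀ p ∈ S, p < c.1) {u : Flag c → ZMod 2}
    (u_adj : ∀ i ≠ 2, ∀ x, u (x.adj i) = u x)
    (u_adj_two : ∀ x, x.elem 1 ∉ S → u (x.adj 2) = u x) {x y : Flag c}
    (hx : x.elem 2 ∉ S) (hy : y.elem 2 ∉ S) : u x = u y := by
  classical
  have := Fintype.ofFinite (Flag c)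
  obtain ⟨h, h_adj, h_sum⟩ := exists_sum_eq_single_add_single adj_involutive (reflTransGen_adj x y)
  have h_sum_apply (z : Flag c) :
      ∑ i, h i z = (Pi.single x 1 + Pi.single y 1 : Flag c → ZMod 2) z := by
    rw [← h_sum, Finset.sum_apply]
  obtain ⟨g, hg⟩ := exists_primitive hS S_lt h_adj fun z hz => by
    have hzx : z ≠ x := fun e => hx (e ▸ hz)
    have hzy : z ≠ y := fun e => hy (e ▸ hz)
    simp [h_sum_apply, hzx, hzy]
  have pairing (z : Flag c) : u z * ∑ i, h i z = u z * h 0 z + u z * h 1 z +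
      ((if z.elem 1 ∈ S then 0 else u z * (h 2 z + g (z.elem 0))) +
        (if z.elem 1 ∈ S then u z * g (z.elem 1) else 0) + u z * g (z.elem 0)) := by
    rw [Fin.sum_univ_three]
    split_ifs with hz
    · rw [hg z (S_lower (z.elem_mono (by decide)) hz) hz]
      ring
    · linear_combination -CharTwo.add_self_eq_zero (u z * g (z.elem 0))
  have sum_pairing : ∑ z, u z * ∑ i, h i z = 0 := by
    simp only [pairing, Finset.sum_add_distrib]
    rw [sum_eq_zero_of_adj 0, sum_eq_zero_of_adj 1, sum_eq_zero_of_adj 2, sum_eq_zero_of_adj 0,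
      sum_eq_zero_of_adj 1]
    · simp only [add_zero]
    · exact fun z => by rw [u_adj 1 (by decide), elem_adj (by decide)]
    · exact fun z => by rw [u_adj 0 (by decide), elem_adj (by decide)]
    · intro z
      rw [elem_adj (by decide), elem_adj (by decide), h_adj]
      exact ite_congr rfl (fun _ => rfl) fun hz => by rw [u_adj_two z hz]
    · exact fun z => by rw [u_adj 1 (by decide), h_adj]
    · exact fun z => by rw [u_adj 0 (by decide), h_adj]
  simp only [h_sum_apply, Pi.add_apply, mul_add, Finset.sum_add_distrib, Pi.single_apply,
    mul_ite, mul_one, mul_zero, Finset.sum_ite_eq', Finset.mem_univ, if_true] at sum_pairing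
  exact CharTwo.add_eq_zero.1 sum_pairing

end Flag

end ColexGraph

namespace ColexGraph

variable {V : Type*} {G : ColexGraph V} {α : Fin 4 → V → Fin 4 → ZMod 2}
  {z : Fin 4 → Fin 4 → ZMod 2}

theorem IsPotential.eq_of_mem_component (hα : G.IsPotential α) {s : Finset (Fin 4)} {κ : Fin 4}
    (hκ : κ ∉ s) {v w : V} (hw : w ∈ G.component s v) : α κ w = α κ v :=
  G.eq_of_mem_component (F := α κ) (fun l hl v => hα.nbr κ l v fun e => hκ (e ▸ hl)) hw

theorem IsPotential.eq_of_mem (hα : G.IsPotential α) (x : G.Elem) {κ : Fin 4} (hκ : κ ∉ x.1.1)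
    {v w : V} (hv : v ∈ x.1.2) (hw : w ∈ x.1.2) : α κ w = α κ v :=
  hα.eq_of_mem_component hκ (x.eq_component hv ▸ hw)

/-- On both sides of the face `f` the potential `α` is given by the rows of `z`. -/
def AgreesOnFace (G : ColexGraph V) (α : Fin 4 → V → Fin 4 → ZMod 2)
    (z : Fin 4 → Fin 4 → ZMod 2) (f : G.Face) : Prop :=
  ∀ v ∈ G.verts f, ∀ κ ∉ f.1.1.1, α κ v = z κ

/-- In the cell `c` the potential `α` is given by the row of `z` of the colour of `c`. -/
def AgreesOnCell (G : ColexGraph V) (α : Fin 4 → V → Fin 4 → ZMod 2)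
    (z : Fin 4 → Fin 4 → ZMod 2) (c : G.Cell) : Prop :=
  ∀ v ∈ c.1.1.2, ∀ κ ∉ c.1.1.1, α κ v = z κ

theorem AgreesOnFace.agreesOnCell (hα : G.IsPotential α) {f : G.Face} (h : G.AgreesOnFace α z f)
    {c : G.Cell} (hfc : G.IsFaceOf f c) : G.AgreesOnCell α z c := fun v hv κ hκ => by
  obtain ⟨w, hw⟩ := f.1.nonempty
  rw [← h w hw κ fun hf => hκ (hfc.1 hf)]
  exact hα.eq_of_mem c.1 hκ (hfc.2 hw) hv

theorem AgreesOnFace.of_rows (hα : G.IsPotential α) {f : G.Face} {v : V} (hv : v ∈ G.verts f)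
    {κ l : Fin 4} (hf : f.1.1.1 = {κ, l}ᶜ) (hκ : α κ v = z κ) (hl : α l v = z l) :
    G.AgreesOnFace α z f := fun w hw i hi => by
  rw [hα.eq_of_mem f.1 hi hv hw]
  simp only [hf, Finset.mem_compl, Finset.mem_insert, Finset.mem_singleton, not_not] at hi
  obtain rfl | rfl := hi
  exacts [hκ, hl]

theorem AgreesOnFace.of_faceValue_eq_zero {τ : G.Face → ZMod 2} (hα : G.IsCoboundary α τ)
    (hz : z ∈ cycleSpace) {f f' : G.Face} {v : V} (hv : v ∈ G.verts f) (hv' : v ∈ G.verts f')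
    {κ l m : Fin 4} (hκl : κ ≠ l) (hκm : κ ≠ m) (hlm : l ≠ m) (hf : f.1.1.1 = {κ, l}ᶜ)
    (hf' : f'.1.1.1 = {κ, m}ᶜ) (h : G.AgreesOnFace α z f) (hτ : τ f' = 0)
    (hτv : G.faceValue τ {l, m}ᶜ v = 0) : G.AgreesOnFace α z f' := by
  have row_κ : α κ v = z κ := h v hv κ (by simp [hf])
  have row_l : α l v = z l := h v hv l (by simp [hf])
  rw [← faceValue_of_mem τ f' hv', hf', hα.faceValue_eq κ m hκm, CharTwo.add_eq_zero] at hτ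
  rw [hα.faceValue_eq l m hlm, CharTwo.add_eq_zero] at hτv
  refine .of_rows hα.toIsPotential hv' hf' row_κ ?_
  exact (row_eq_of_row_eq hz hκl hκm hlm (hα.mem_rowSpace m v) (row_κ ▸ hτ) (row_l ▸ hτv)).symm

/-- `P α τ` holds for the potentials `α` with coboundary `τ` as soon as `τ` vanishes on a set of at
most `r` faces in `Φ`. The point is that the set depends neither on `α` nor on `τ`. -/
def Forced (G : ColexGraph V) (Φ : Set G.Face) (r : ℝ≥0)
    (P : (Fin 4 → V → Fin 4 → ZMod 2) → (G.Face → ZMod 2) → Prop) : Prop :=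
  ∃ M : Finset G.Face, ↑M ⊆ Φ ∧ (M.card : ℝ≥0) ≤ r ∧
    ∀ α τ, G.IsCoboundary α τ → (∀ f ∈ M, τ f = 0) → P α τ

section Forced

variable {Φ : Set G.Face} {r s : ℝ≥0}
  {P Q : (Fin 4 → V → Fin 4 → ZMod 2) → (G.Face → ZMod 2) → Prop}

theorem Forced.mono (h : G.Forced Φ r P) (hrs : r ≤ s)
    (hPQ : ∀ α τ, G.IsCoboundary α τ → P α τ → Q α τ) : G.Forced Φ s Q :=
  h.imp fun _ hM => ⟨hM.1, hM.2.1.trans hrs, fun α τ hα hτ => hPQ α τ hα (hM.2.2 α τ hα hτ)⟩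

theorem Forced.and (hP : G.Forced Φ r P) (hQ : G.Forced Φ s Q) :
    G.Forced Φ (r + s) fun α τ => P α τ ∧ Q α τ := by
  obtain ⟨M, M_subset, card_M, forces_P⟩ := hP
  obtain ⟨N, N_subset, card_N, forces_Q⟩ := hQ
  refine ⟨M ∪ N, ?_, ?_, fun α τ hα hτ =>
    ⟨forces_P α τ hα fun f hf => hτ f (Finset.mem_union_left _ hf),
      forces_Q α τ hα fun f hf => hτ f (Finset.mem_union_right _ hf)⟩⟩
  · rw [Finset.coe_union]
    exact Set.union_subset M_subset N_subset
  · calc ((M ∪ N).card : ℝ≥0) ≤ M.card + N.card := mod_cast Finset.card_union_le M N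
      _ ≤ r + s := add_le_add card_M card_N

theorem Forced.of_forall (h : ∀ α τ, G.IsCoboundary α τ → P α τ) : G.Forced Φ r P :=
  ⟨∅, by simp, by simp, fun α τ hα _ => h α τ hα⟩

theorem Forced.eq_zero {f : G.Face} (hf : f ∈ Φ) : G.Forced Φ 1 fun _ τ => τ f = 0 :=
  ⟨{f}, by simpa using hf, by simp, fun _ _ _ hτ => hτ f (Finset.mem_singleton_self f)⟩

theorem Forced.forall_mem {ι : Type*} {t : Finset ι} {r : ι → ℝ≥0}
    {P : ι → (Fin 4 → V → Fin 4 → ZMod 2) → (G.Face → ZMod 2) → Prop}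
    (h : ∀ i ∈ t, G.Forced Φ (r i) (P i)) :
    G.Forced Φ (∑ i ∈ t, r i) fun α τ => ∀ i ∈ t, P i α τ := by
  classical
  induction t using Finset.induction_on with
  | empty => exact .of_forall fun _ _ _ _ hi => absurd hi (Finset.notMem_empty _)
  | insert i t hit ih =>
    rw [Finset.forall_mem_insert] at h
    exact (h.1.and (ih h.2)).mono (Finset.sum_insert hit).ge
      fun _ _ _ hP => (Finset.forall_mem_insert ..).2 hP

end Forced

theorem exists_colors_eq_compl_pair {f f' c : Finset (Fin 4)} (hf : f.card = 2)
    (hf' : f'.card = 2) (hc : c.card = 3) (hfc : f ⊆ c) (hfc' : f' ⊆ c) (hne : f ≠ f') :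
    ∃ κ l m, κ ≠ l ∧ κ ≠ m ∧ l ≠ m ∧ f = {κ, l}ᶜ ∧ f' = {κ, m}ᶜ := by
  revert f f' c
  decide

theorem compl_pair_subset_or_subset {l m : Fin 4} {c : Finset (Fin 4)} (hc : c.card = 3)
    (h : {l, m}ᶜ ⊆ c) (κ : Fin 4) : {κ, l}ᶜ ⊆ c ∨ {κ, m}ᶜ ⊆ c := by
  revert κ l m c
  decide

end ColexGraph

namespace TetrahedralColex

variable {V : Type*} {T : TetrahedralColex V} {C : Set T.Cell} {c : T.Cell}

theorem forced_faceValue_eq_zero {f f' : T.Face} (hfC : f ∉ T.facesOf C) (hfC' : f' ∉ T.facesOf C)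
    {v : V} (hv : v ∈ T.verts f) (hv' : v ∈ T.verts f') {κ l m : Fin 4} (hlm : l ≠ m)
    (hf : f.1.1.1 = {κ, l}ᶜ) (hf' : f'.1.1.1 = {κ, m}ᶜ) :
    T.Forced (T.facesOf C)ᶜ 1 fun _ τ => T.faceValue τ {l, m}ᶜ v = 0 := by
  by_cases hout : T.out ∈ T.component {l, m}ᶜ v
  · exact .of_forall fun _ τ _ => ColexGraph.faceValue_eq_zero τ hout
  have card_eq : ({l, m}ᶜ : Finset (Fin 4)).card = 2 := by
    rw [Finset.card_compl, Finset.card_pair hlm, Fintype.card_fin]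
  let g : T.Face := ⟨T.elem {l, m}ᶜ v (card_eq ▸ by norm_num) hout, card_eq⟩
  have hvg : v ∈ T.verts g := T.mem_component_self _ v
  have hgC : g ∉ T.facesOf C := fun ⟨c, hc, hgc⟩ => by
    obtain h | h := ColexGraph.compl_pair_subset_or_subset c.2 hgc.1 κ
    · exact hfC ⟨c, hc, (ColexGraph.Elem.le_iff_of_mem hv (hgc.2 hvg)).2 (hf ▸ h)⟩
    · exact hfC' ⟨c, hc, (ColexGraph.Elem.le_iff_of_mem hv' (hgc.2 hvg)).2 (hf' ▸ h)⟩
  exact (ColexGraph.Forced.eq_zero hgC).mono le_rfl fun _ τ _ h =>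
    (ColexGraph.faceValue_of_mem τ g hvg).trans h

theorem forced_agreesOnFace_of_inter_nonempty {f f' : T.Face} (hf : T.IsFaceOf f c)
    (hf' : T.IsFaceOf f' c) (hfC : f ∉ T.facesOf C) (hfC' : f' ∉ T.facesOf C)
    (hff' : (T.verts f ∩ T.verts f').Nonempty) :
    T.Forced (T.facesOf C)ᶜ 2 fun α _ => ∀ z ∈ cycleSpace,
      T.AgreesOnFace α z f → T.AgreesOnFace α z f' := by
  obtain rfl | hne := eq_or_ne f f'
  · exact .of_forall fun _ _ _ _ _ h => h
  obtain ⟨v, hv, hv'⟩ := hff'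
  obtain ⟨κ, l, m, hκl, hκm, hlm, hfκ, hfκ'⟩ := ColexGraph.exists_colors_eq_compl_pair f.2 f'.2 c.2
    hf.1 hf'.1 fun h => hne (Subtype.ext (ColexGraph.Elem.ext_of_mem h hv hv'))
  have forced := forced_faceValue_eq_zero hfC hfC' hv hv' hlm hfκ hfκ'
  refine ((ColexGraph.Forced.eq_zero hfC').and forced).mono one_add_one_eq_two.le ?_
  exact fun α τ hα hτ z hz h => .of_faceValue_eq_zero hα hz hv hv' hκl hκm hlm hfκ hfκ' h hτ.1 hτ.2

/-- The faces of the cell `c` that belong to no cell of `C`, adjacent when they share a vertex. -/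
def openFaceGraph (C : Set T.Cell) (c : T.Cell) :
    SimpleGraph {f : T.Face // T.IsFaceOf f c ∧ f ∉ T.facesOf C} :=
  SimpleGraph.fromRel fun f f' => (T.verts f.1 ∩ T.verts f'.1).Nonempty

theorem forced_agreesOnFace_of_walk {f f' : {f : T.Face // T.IsFaceOf f c ∧ f ∉ T.facesOf C}}
    (p : (openFaceGraph C c).Walk f f') :
    T.Forced (T.facesOf C)ᶜ (2 * p.length) fun α _ => ∀ z ∈ cycleSpace,
      T.AgreesOnFace α z f.1 → T.AgreesOnFace α z f'.1 := by
  induction p with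
  | nil => exact .of_forall fun _ _ _ _ _ h => h
  | @cons f g _ hfg p ih =>
    have inter_nonempty : (T.verts f.1 ∩ T.verts g.1).Nonempty := by
      rw [openFaceGraph, SimpleGraph.fromRel_adj, Set.inter_comm (T.verts g.1), or_self] at hfg
      exact hfg.2
    have forced := forced_agreesOnFace_of_inter_nonempty f.2.1 g.2.1 f.2.2 g.2.2 inter_nonempty
    refine (forced.and ih).mono ?_ fun α _ _ h z hz hf => h.2 z hz (h.1 z hz hf)
    rw [SimpleGraph.Walk.length_cons, Nat.cast_succ, mul_add_one, add_comm]

theorem points_inter_eq_realization (C : Set T.Cell) (c : T.Cell) :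
    T.points c ∩ (⋃ c' ∈ C, T.points c') =
      realization {e : T.toColexGraph.Elem | e ≤ c.1 ∧ ∃ c' ∈ C, e ≤ c'.1} := by
  have := T.finite
  ext w
  refine ⟨fun ⟨hc, hC⟩ => ?_, fun hw => ⟨⟨hw.1, hw.2.1, fun e he => (hw.2.2.1 he).1, hw.2.2.2⟩, ?_⟩⟩
  · obtain ⟨c', hc', hwc'⟩ := Set.mem_iUnion₂.1 hC
    exact ⟨hc.1, hc.2.1, fun e he => ⟨hc.2.2.1 he, c', hc', hwc'.2.2.1 he⟩, hc.2.2.2⟩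
  · have support_nonempty : (Function.support w).Nonempty := by
      rw [Function.support_nonempty_iff]
      rintro rfl
      simpa using hw.2.1
    obtain ⟨m, hm⟩ := (Set.toFinite (Function.support w)).exists_maximal support_nonempty
    obtain ⟨c', hc', hmc'⟩ := (hw.2.2.1 hm.1).2
    refine Set.mem_iUnion₂.2 ⟨c', hc', hw.1, hw.2.1, fun e he => ?_, hw.2.2.2⟩
    obtain h | h := hw.2.2.2.total he hm.1
    exacts [h.trans hmc', (hm.2 he h).trans hmc']

theorem orderAcyclic_of_points_inter (h : T.points c ∩ (⋃ c' ∈ C, T.points c') = ∅ ∨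
      IsSimplyConnected (T.points c ∩ (⋃ c' ∈ C, T.points c'))) (A : Type*) [AddCommGroup A] :
    OrderAcyclic {e : T.toColexGraph.Elem | e ≤ c.1 ∧ ∃ c' ∈ C, e ≤ c'.1} A := by
  have := T.finite
  rw [points_inter_eq_realization] at h
  obtain h | h := h
  · refine fun _ _ => ⟨0, fun e he => ?_⟩
    obtain ⟨w, hw, -⟩ := exists_mem_realization_support_eq (Finset.singleton_nonempty e)
      (by rwa [Finset.coe_singleton, Set.singleton_subset_iff]) (by simp)
    exact (Set.notMem_empty w (h ▸ hw)).elim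
  · exact .of_isSimplyConnected h A

theorem exists_reachable_elem_adj_two {x : ColexGraph.Flag c}
    (hx : x.elem 1 ∉ {e : T.toColexGraph.Elem | e ≤ c.1 ∧ ∃ c' ∈ C, e ≤ c'.1})
    {g : {f : T.Face // T.IsFaceOf f c ∧ f ∉ T.facesOf C}} (hg : g.1.1 = x.elem 2) :
    ∃ g', (openFaceGraph C c).Reachable g g' ∧ g'.1.1 = (x.adj 2).elem 2 := by
  have isFaceOf : (x.adj 2).elem 2 ≤ c.1 :=
    ⟨(x.adj 2).colors_subset 2, (x.adj 2).component_subset 2⟩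
  have edge_le : x.elem 1 ≤ (x.adj 2).elem 2 :=
    ColexGraph.Flag.elem_adj (i := 2) (j := 1) (by decide) x ▸ (x.adj 2).elem_mono (by decide)
  let g' : {f : T.Face // T.IsFaceOf f c ∧ f ∉ T.facesOf C} :=
    ⟨⟨(x.adj 2).elem 2, (x.adj 2).card_elem 2⟩, isFaceOf,
      fun ⟨c', hc', h⟩ => hx ⟨edge_le.trans isFaceOf, c', hc', edge_le.trans h⟩⟩
  refine ⟨g', ?_, rfl⟩
  obtain rfl | hne := eq_or_ne g g'
  · rfl
  · refine SimpleGraph.Adj.reachable ((SimpleGraph.fromRel_adj _ _ _).2 ⟨hne, .inl ⟨x.v, ?_, ?_⟩⟩)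
    · exact (congrArg (x.v ∈ ·.1.2) hg).mpr (x.v_mem_elem 2)
    · exact (x.adj 2).v_mem_elem 2

theorem openFaceGraph_preconnected (hc : c ∉ C)
    (h : T.points c ∩ (⋃ c' ∈ C, T.points c') = ∅ ∨
      IsSimplyConnected (T.points c ∩ (⋃ c' ∈ C, T.points c'))) :
    (openFaceGraph C c).Preconnected := by
  classical
  have := T.finite
  intro f f'
  let S : Set T.toColexGraph.Elem := {e | e ≤ c.1 ∧ ∃ c' ∈ C, e ≤ c'.1}
  have S_lower : IsLowerSet S := fun x y hyx hx =>
    ⟨hyx.trans hx.1, hx.2.imp fun _ h => ⟨h.1, hyx.trans h.2⟩⟩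
  have S_lt : ∀ e ∈ S, e < c.1 := by
    rintro e ⟨hec, c', hc', hec'⟩
    refine hec.lt_of_ne ?_
    rintro rfl
    exact hc (Subtype.ext (ColexGraph.Elem.eq_of_le_of_card hec' (by rw [c.2, c'.2])) ▸ hc')
  let Reached (x : ColexGraph.Flag c) : Prop :=
    ∃ g, (openFaceGraph C c).Reachable f g ∧ g.1.1 = x.elem 2
  have reached_adj_two {x : ColexGraph.Flag c} (hx : x.elem 1 ∉ S) (h : Reached x) :
      Reached (x.adj 2) := by
    obtain ⟨g, hfg, hg⟩ := h
    obtain ⟨g', hgg', hg'⟩ := exists_reachable_elem_adj_two hx hg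
    exact ⟨g', hfg.trans hgg', hg'⟩
  obtain ⟨x, hx⟩ := ColexGraph.Flag.exists_elem_two_eq f.2.1
  obtain ⟨y, hy⟩ := ColexGraph.Flag.exists_elem_two_eq f'.2.1
  have face_notMem (g : {f : T.Face // T.IsFaceOf f c ∧ f ∉ T.facesOf C}) : g.1.1 ∉ S :=
    fun ⟨_, hg⟩ => g.2.2 hg
  have u_eq := ColexGraph.Flag.eq_of_adj_eq (orderAcyclic_of_points_inter h _) S_lower S_lt
    (u := fun x => if Reached x then 1 else 0) (x := x) (y := y)
    (fun i hi z => by simp only [Reached, ColexGraph.Flag.elem_adj hi.symm])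
    (fun z hz => if_congr ⟨fun h => by
        rw [← ColexGraph.Flag.adj_involutive 2 z]
        exact reached_adj_two (by rwa [ColexGraph.Flag.elem_adj (by decide)]) h,
      reached_adj_two hz⟩ rfl rfl) (hx ▸ face_notMem f) (hy ▸ face_notMem f')
  have reached_x : Reached x := ⟨f, .refl f, hx.symm⟩
  obtain ⟨g, hfg, hg⟩ : Reached y := by simpa [reached_x] using u_eq
  obtain rfl : g = f' := Subtype.ext (Subtype.ext (hg.trans hy))
  exact hfg

theorem walk_length_lt {kface : ℕ} (hface : {f : T.Face | T.IsFaceOf f c}.ncard ≤ kface)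
    {f f' : {f : T.Face // T.IsFaceOf f c ∧ f ∉ T.facesOf C}} {p : (openFaceGraph C c).Walk f f'}
    (hp : p.IsPath) : p.length < kface := by
  have := T.finite
  have := Fintype.ofFinite {f : T.Face // T.IsFaceOf f c ∧ f ∉ T.facesOf C}
  calc p.length < Fintype.card {f : T.Face // T.IsFaceOf f c ∧ f ∉ T.facesOf C} := hp.length_lt
    _ = {f : T.Face | T.IsFaceOf f c ∧ f ∉ T.facesOf C}.ncard := by
      rw [← Nat.card_eq_fintype_card, ← Nat.card_coe_set_eq, Set.coe_ofPred]
    _ ≤ {f : T.Face | T.IsFaceOf f c}.ncard :=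
      Set.ncard_le_ncard (fun _ hf => hf.1) (Set.toFinite _)
    _ ≤ kface := hface

/-- Within any cell, whether a cycle gives the potential on a face outside `facesOf C` can be
transferred to any other such face of the cell at the cost of `K` faces outside `facesOf C`. -/
def Propagates (T : TetrahedralColex V) (C : Set T.Cell) (K : ℝ≥0) : Prop :=
  ∀ (c : T.Cell) (f f' : T.Face), T.IsFaceOf f c → T.IsFaceOf f' c → f ∉ T.facesOf C →
    f' ∉ T.facesOf C → T.Forced (T.facesOf C)ᶜ K fun α _ => ∀ z ∈ cycleSpace,
      T.AgreesOnFace α z f → T.AgreesOnFace α z f'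

theorem propagates {kface : ℕ} (hface : ∀ c : T.Cell, {f : T.Face | T.IsFaceOf f c}.ncard ≤ kface)
    (hsimple : ∀ c ∉ C, T.points c ∩ (⋃ c' ∈ C, T.points c') = ∅ ∨
      IsSimplyConnected (T.points c ∩ (⋃ c' ∈ C, T.points c'))) :
    T.Propagates C (2 * ((kface - 1 : ℕ) : ℝ≥0)) := by
  intro c f f' hf hf' hfC hfC'
  have hc : c ∉ C := fun hc => hfC ⟨c, hc, hf⟩
  obtain ⟨p, hp⟩ := (openFaceGraph_preconnected hc (hsimple c hc) ⟨f, hf, hfC⟩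
    ⟨f', hf', hfC'⟩).exists_isPath
  refine (forced_agreesOnFace_of_walk p).mono ?_ fun _ _ _ h => h
  gcongr
  exact Nat.le_sub_one_of_lt (walk_length_lt (hface c) hp)

theorem two_le_ncard_isFaceOf (c : T.Cell) : 2 ≤ {f : T.Face | T.IsFaceOf f c}.ncard := by
  have := T.finite
  obtain ⟨v, hv⟩ := c.1.nonempty
  obtain ⟨t, ht, card_t⟩ := Finset.exists_subset_card_eq
    (show 2 ≤ c.1.1.1.card by rw [c.2]; norm_num)
  obtain ⟨a, ha⟩ := Finset.card_pos.1 (card_t ▸ two_pos)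
  obtain ⟨x, -⟩ := ColexGraph.Flag.exists_v_eq_a_eq_colors_two_eq hv ht card_t ha
  let f (x : ColexGraph.Flag c) : T.Face := ⟨x.elem 2, x.card_elem 2⟩
  have hne : f x ≠ f (x.adj 2) := fun h => x.adj_ne 2 <|
    ColexGraph.Flag.eq_of_colors_two_eq rfl rfl (congrArg (·.1.1.1) h).symm
  have isFaceOf (x : ColexGraph.Flag c) : T.IsFaceOf (f x) c :=
    ⟨x.colors_subset 2, x.component_subset 2⟩
  rw [← Set.ncard_pair hne]
  exact Set.ncard_le_ncard (Set.pair_subset (isFaceOf x) (isFaceOf _)) (Set.toFinite _)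

end TetrahedralColex

namespace ColexGraph

theorem exists_eq_compl_pair {s : Finset (Fin 4)} (hs : s.card = 2) :
    ∃ κ l, κ ≠ l ∧ s = {κ, l}ᶜ := by
  revert s
  decide

theorem exists_eq_compl_singleton {s : Finset (Fin 4)} (hs : s.card = 3) : ∃ κ, s = {κ}ᶜ := by
  revert s
  decide

variable {V : Type*} {G : ColexGraph V} {α : Fin 4 → V → Fin 4 → ZMod 2} {τ : G.Face → ZMod 2}

theorem IsPotential.exists_agreesOnCell (hα : G.IsPotential α) (c : G.Cell) :
    ∃ z ∈ cycleSpace, G.AgreesOnCell α z c := by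
  obtain ⟨v, hv⟩ := c.1.nonempty
  obtain ⟨κ, hκ⟩ := exists_eq_compl_singleton c.2
  obtain ⟨z, hz, hzκ⟩ := exists_mem_cycleSpace_of_row (hα.mem_rowSpace κ v)
  refine ⟨z, hz, fun w hw l hl => ?_⟩
  obtain rfl : l = κ := by simpa [hκ] using hl
  rw [hzκ, hα.eq_of_mem c.1 hl hv hw]

theorem IsCoboundary.exists_agreesOnFace (hα : G.IsCoboundary α τ) {f : G.Face} (hf : τ f = 0) :
    ∃ z ∈ cycleSpace, G.AgreesOnFace α z f := by
  obtain ⟨v, hv⟩ := f.1.nonempty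
  obtain ⟨κ, l, hκl, hfκ⟩ := exists_eq_compl_pair f.2
  rw [← faceValue_of_mem τ f hv, hfκ, hα.faceValue_eq κ l hκl, CharTwo.add_eq_zero] at hf
  obtain ⟨z, hz, hzκ, hzl⟩ :=
    exists_mem_cycleSpace_of_rows hκl (hα.mem_rowSpace κ v) (hα.mem_rowSpace l v) hf
  exact ⟨z, hz, .of_rows hα.toIsPotential hv hfκ hzκ.symm hzl.symm⟩

theorem AgreesOnFace.row_eq_zero {z : Fin 4 → Fin 4 → ZMod 2} {f : G.Face}
    (h : G.AgreesOnFace α z f) (hα : G.IsPotential α) {κ : Fin 4} (hf : G.OnFacet κ f) :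
    z κ = 0 := by
  obtain ⟨v, hv⟩ := f.1.nonempty
  rw [← h v hv κ fun hκ => by simpa using hf.1 hκ, ← hα.out κ]
  exact hα.eq_of_mem_component (by simp) (hf.2 hv)

end ColexGraph

namespace TetrahedralColex

variable {V : Type*} {T : TetrahedralColex V} {C : Set T.Cell} {K : ℝ≥0}

/-- `OpenTree C n B F`: the cells `B` are joined in the dual graph through `n` edges, dual to the
faces `F`, none of which belongs to a cell of `C`. -/
inductive OpenTree (C : Set T.Cell) : ℕ → Set T.Cell → Set T.Face → Prop
  | single (c : T.Cell) : OpenTree C 0 {c} ∅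
  | step {n : ℕ} {B : Set T.Cell} {F : Set T.Face} {c : T.Cell} {f : T.Face} :
      OpenTree C n B F → c ∈ B → f ∉ T.facesOf C → T.IsFaceOf f c →
      OpenTree C (n + 1) (B ∪ {c' | T.IsFaceOf f c'}) (insert f F)

/-- A single cycle gives the potential `α` on all cells in `B` and on all faces in `F`. -/
def IsConstantOn (T : TetrahedralColex V) (B : Set T.Cell) (F : Set T.Face)
    (α : Fin 4 → V → Fin 4 → ZMod 2) : Prop :=
  ∃ z ∈ cycleSpace, (∀ c ∈ B, T.AgreesOnCell α z c) ∧ ∀ f ∈ F, T.AgreesOnFace α z f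

namespace OpenTree

variable {n : ℕ} {B : Set T.Cell} {F : Set T.Face}

theorem eq_singleton_or_forall_exists (h : OpenTree C n B F) :
    (n = 0 ∧ (∃ c, B = {c}) ∧ F = ∅) ∨ ∀ c ∈ B, ∃ f ∈ F, T.IsFaceOf f c := by
  induction h with
  | single c => exact .inl ⟨rfl, ⟨c, rfl⟩, rfl⟩
  | @step n B F c f _ hc _ hfc ih =>
    refine .inr ?_
    rintro c' (hc' | hc')
    · obtain ⟨-, ⟨_, rfl⟩, -⟩ | ih := ih
      · exact ⟨f, Set.mem_insert _ _,
          Set.mem_singleton_iff.1 hc' ▸ Set.mem_singleton_iff.1 hc ▸ hfc⟩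
      · exact (ih c' hc').imp fun _ h => ⟨Set.mem_insert_of_mem _ h.1, h.2⟩
    · exact ⟨f, Set.mem_insert _ _, hc'⟩

theorem notMem_facesOf (h : OpenTree C n B F) : ∀ f ∈ F, f ∉ T.facesOf C := by
  induction h with
  | single => simp
  | step _ _ hf _ ih => exact Set.forall_mem_insert.2 ⟨hf, ih⟩

theorem forced (hK : 1 ≤ K) (hT : T.Propagates C K) (h : OpenTree C n B F) :
    T.Forced (T.facesOf C)ᶜ (n * K) fun α _ => T.IsConstantOn B F α := by
  induction h with
  | single c =>
    refine .of_forall fun α _ hα => ?_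
    obtain ⟨z, hz, hzc⟩ := hα.toIsPotential.exists_agreesOnCell c
    exact ⟨z, hz, by simpa using hzc, by simp⟩
  | @step n B F c f tree hc hf hfc ih =>
    obtain ⟨rfl, ⟨_, rfl⟩, rfl⟩ | exists_face := tree.eq_singleton_or_forall_exists
    · obtain rfl := Set.mem_singleton_iff.1 hc
      refine (ColexGraph.Forced.eq_zero hf).mono (by simpa using hK) fun α τ hα hτ => ?_
      obtain ⟨z, hz, hzf⟩ := hα.exists_agreesOnFace hτ
      refine ⟨z, hz, ?_, by simpa using hzf⟩
      rintro c' (rfl | hc')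
      exacts [hzf.agreesOnCell hα.toIsPotential hfc, hzf.agreesOnCell hα.toIsPotential hc']
    · obtain ⟨g, hg, hgc⟩ := exists_face c hc
      refine (ih.and (hT c g f hgc hfc (tree.notMem_facesOf g hg) hf)).mono ?_ ?_
      · rw [Nat.cast_succ, add_one_mul]
      · rintro α τ hα ⟨⟨z, hz, hzB, hzF⟩, agrees⟩
        have hzf := agrees z hz (hzF g hg)
        exact ⟨z, hz, fun c' hc' => hc'.elim (hzB c') (hzf.agreesOnCell hα.toIsPotential),
          Set.forall_mem_insert.2 ⟨hzf, hzF⟩⟩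

theorem exists_of_walk (h : OpenTree C n B F) {v v' : T.Cell}
    (p : (T.dualGraph (T.facesOf C)ᶜ).Walk v v') (hv : v ∈ B) :
    ∃ B' F', OpenTree C (n + p.length) B' F' ∧ B ⊆ B' ∧ F ⊆ F' ∧ v' ∈ B' := by
  induction p generalizing n B F with
  | nil => exact ⟨B, F, h, subset_rfl, subset_rfl, hv⟩
  | cons hadj p ih =>
    obtain ⟨-, f, hf, hfv, hfu⟩ := hadj
    obtain ⟨B', F', h', hB, hF, hv'⟩ := ih (h.step hv hf hfv) (.inr hfu)
    rw [add_assoc, add_comm 1] at h'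
    exact ⟨B', F', h', Set.subset_union_left.trans hB, (Set.subset_insert _ _).trans hF, hv'⟩

theorem exists_of_dist (h : OpenTree C n B F) {v v' : T.Cell} {d : ℕ}
    (hd : T.dist (T.facesOf C)ᶜ v v' ≤ d) (hv : v ∈ B) :
    ∃ n' ≤ n + d, ∃ B' F', OpenTree C n' B' F' ∧ B ⊆ B' ∧ F ⊆ F' ∧ v' ∈ B' := by
  obtain ⟨p, hp⟩ := SimpleGraph.exists_walk_of_edist_ne_top
    (ne_top_of_le_ne_top (ENat.natCast_ne_top d) hd)
  have length_le : p.length ≤ d := by exact_mod_cast hp.trans_le hd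
  exact ⟨n + p.length, by lia, h.exists_of_walk p hv⟩

theorem exists_of_facetDist (h : OpenTree C n B F) {v : T.Cell} {κ : Fin 4} {d : ℕ}
    (hd : T.facetDist (T.facesOf C)ᶜ κ v ≤ d) (hv : v ∈ B) :
    ∃ n' ≤ n + d, ∃ B' F', OpenTree C n' B' F' ∧ B ⊆ B' ∧ F ⊆ F' ∧ ∃ f ∈ F', T.OnFacet κ f := by
  have dist_lt : T.facetDist (T.facesOf C)ᶜ κ v < (d + 1 : ℕ) :=
    hd.trans_lt (by exact_mod_cast Nat.lt_succ_self d)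
  obtain ⟨u, hu⟩ := iInf_lt_iff.1 dist_lt
  obtain ⟨⟨f, hf, hfu, hfκ⟩, hu⟩ := iInf_lt_iff.1 hu
  obtain ⟨m, hm⟩ := ENat.ne_top_iff_exists.1 (ne_top_of_le_ne_top hu.ne_top le_self_add)
  rw [← hm] at hu
  have hmd : m + 1 < d + 1 := by exact_mod_cast hu
  obtain ⟨n', hn', B', F', h', hB, hF, hu'⟩ := h.exists_of_dist hm.ge hv
  exact ⟨n' + 1, by lia, _, _, h'.step hu' hf hfu, hB.trans Set.subset_union_left,
    hF.trans (Set.subset_insert _ _), f, Set.mem_insert _ _, hfκ⟩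

end OpenTree

end TetrahedralColex

namespace TetrahedralColex

variable {V : Type*} {T : TetrahedralColex V}

/-- The vertices that the dual graph of the layer of `C` shares with its complement, that is, the
cells with some faces that belong to a cell of `C` and some that do not. -/
def boundaryCells (T : TetrahedralColex V) (C : Set T.Cell) : Set T.Cell :=
  T.dualVertices (T.facesOf C) ∩ T.dualVertices (T.facesOf C)ᶜ

/-- Distances from boundary cells grow by at most a factor `k` when the paths are confined to the
complement of the layer of `C` instead of the layer itself. A path to a facet may be replaced by a
pair of paths to two other ones. -/
structure DistBound (T : TetrahedralColex V) (C : Set T.Cell) (k : ℝ≥0) : Prop where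
  dist : ∀ v ∈ T.boundaryCells C, ∀ v' ∈ T.boundaryCells C,
    (T.dist (T.facesOf C)ᶜ v v' : ℝ≥0∞) ≤ k * (T.dist (T.facesOf C) v v' : ℝ≥0∞)
  facet : ∀ κ : Fin 4, ∀ v ∈ T.boundaryCells C,
    (min (T.facetDist (T.facesOf C)ᶜ κ v) (T.twoFacetDist (T.facesOf C)ᶜ v) : ℝ≥0∞) ≤
      k * (T.facetDist (T.facesOf C) κ v : ℝ≥0∞)

theorem exists_nat_eq_of_toENNReal_le {x y : ℕ∞} {k : ℝ≥0} {m : ℕ}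
    (hx : (x : ℝ≥0∞) ≤ k * (y : ℝ≥0∞)) (hy : y ≤ m) :
    ∃ d : ℕ, x = d ∧ (d : ℝ≥0) ≤ k * m := by
  have bound : (x : ℝ≥0∞) ≤ ((k * m : ℝ≥0) : ℝ≥0∞) := by
    push_cast
    refine hx.trans ?_
    gcongr
    exact_mod_cast ENat.toENNReal_le.2 hy
  obtain ⟨d, rfl⟩ := ENat.ne_top_iff_exists.1 fun x_eq_top : x = ⊤ => by
    rw [x_eq_top, ENat.toENNReal_top] at bound
    exact bound.not_gt ENNReal.coe_lt_top
  exact ⟨d, rfl, by rwa [ENat.toENNReal_coe, ← ENNReal.coe_natCast, ENNReal.coe_le_coe] at bound⟩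

/-- The faces `F` connect to the facet `κ`, or else to two different facets. Either suffices to make
the row `κ` of a cycle that agrees with a potential on all faces in `F` vanish. -/
def Reaches (F : Set T.Face) (κ : Fin 4) : Prop :=
  (∃ f ∈ F, T.OnFacet κ f) ∨
    ∃ a b, a ≠ b ∧ (∃ f ∈ F, T.OnFacet a f) ∧ ∃ f ∈ F, T.OnFacet b f

theorem Reaches.mono {F F' : Set T.Face} (h : F ⊆ F') {κ : Fin 4} :
    Reaches F κ → Reaches F' κ := by
  rintro (⟨f, hf, hfκ⟩ | ⟨a, b, hab, ⟨f, hf, hfa⟩, g, hg, hgb⟩)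
  exacts [.inl ⟨f, h hf, hfκ⟩, .inr ⟨a, b, hab, ⟨f, h hf, hfa⟩, g, h hg, hgb⟩]

theorem Reaches.row_eq_zero {F : Set T.Face} {κ : Fin 4} (hF : Reaches F κ)
    {α : Fin 4 → V → Fin 4 → ZMod 2} (hα : T.IsPotential α) {z : Fin 4 → Fin 4 → ZMod 2}
    (hz : z ∈ cycleSpace) (h : ∀ f ∈ F, T.AgreesOnFace α z f) : z κ = 0 := by
  obtain ⟨f, hf, hfκ⟩ | ⟨a, b, hab, ⟨f, hf, hfa⟩, g, hg, hgb⟩ := hF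
  · exact (h f hf).row_eq_zero hα hfκ
  · rw [eq_zero_of_mem_cycleSpace hz hab ((h f hf).row_eq_zero hα hfa)
      ((h g hg).row_eq_zero hα hgb), Pi.zero_apply]

variable {C : Set T.Cell} {k : ℝ≥0}

namespace OpenTree

variable {n : ℕ} {B : Set T.Cell} {F : Set T.Face}

theorem exists_of_twoFacetDist (h : OpenTree C n B F) {v : T.Cell} {d : ℕ}
    (hd : T.twoFacetDist (T.facesOf C)ᶜ v ≤ d) (hv : v ∈ B) :
    ∃ n' ≤ n + d, ∃ B' F', OpenTree C n' B' F' ∧ B ⊆ B' ∧ F ⊆ F' ∧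
      ∃ a b, a ≠ b ∧ (∃ f ∈ F', T.OnFacet a f) ∧ ∃ f ∈ F', T.OnFacet b f := by
  have dist_lt : T.twoFacetDist (T.facesOf C)ᶜ v < (d + 1 : ℕ) :=
    hd.trans_lt (by exact_mod_cast Nat.lt_succ_self d)
  obtain ⟨a, ha⟩ := iInf_lt_iff.1 dist_lt
  obtain ⟨b, hb⟩ := iInf_lt_iff.1 ha
  obtain ⟨hab, hb⟩ := iInf_lt_iff.1 hb
  obtain ⟨da, hda⟩ := ENat.ne_top_iff_exists.1 (ne_top_of_le_ne_top hb.ne_top le_self_add)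
  obtain ⟨db, hdb⟩ := ENat.ne_top_iff_exists.1 (ne_top_of_le_ne_top hb.ne_top le_add_self)
  rw [← hda, ← hdb] at hb
  have sum_lt : da + db < d + 1 := by exact_mod_cast hb
  obtain ⟨n₁, hn₁, B₁, F₁, h₁, hB₁, hF₁, f, hf, hfa⟩ := h.exists_of_facetDist hda.ge hv
  obtain ⟨n₂, hn₂, B₂, F₂, h₂, hB₂, hF₂, hfb⟩ := h₁.exists_of_facetDist hdb.ge (hB₁ hv)
  exact ⟨n₂, by lia, B₂, F₂, h₂, hB₁.trans hB₂, hF₁.trans hF₂, a, b, hab, ⟨f, hF₂ hf, hfa⟩, hfb⟩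

theorem exists_of_boundary_walk (hk : T.DistBound C k) (h : OpenTree C n B F) {v v' : T.Cell}
    (hv : v ∈ T.boundaryCells C) (hv' : v' ∈ T.boundaryCells C) (hvB : v ∈ B)
    (p : (T.dualGraph (T.facesOf C)).Walk v v') :
    ∃ n' : ℕ, (n' : ℝ≥0) ≤ n + k * p.length ∧ ∃ B' F', OpenTree C n' B' F' ∧ B ⊆ B' ∧ v' ∈ B' := by
  obtain ⟨d, hd, hdk⟩ :=
    exists_nat_eq_of_toENNReal_le (hk.dist v hv v' hv') (SimpleGraph.edist_le p)
  obtain ⟨n', hn', B', F', h', hB, -, hv'B⟩ := h.exists_of_dist hd.le hvB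
  refine ⟨n', ?_, B', F', h', hB, hv'B⟩
  calc (n' : ℝ≥0) ≤ n + d := by exact_mod_cast hn'
    _ ≤ n + k * p.length := by gcongr

theorem exists_of_facet_walk (hk : T.DistBound C k) (h : OpenTree C n B F) {v u : T.Cell}
    (hv : v ∈ T.boundaryCells C) (hvB : v ∈ B) (p : (T.dualGraph (T.facesOf C)).Walk v u)
    {κ : Fin 4} {f : T.Face} (hf : f ∈ T.facesOf C) (hfu : T.IsFaceOf f u) (hfκ : T.OnFacet κ f) :
    ∃ n' : ℕ, (n' : ℝ≥0) ≤ n + k * (p.length + 1) ∧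
      ∃ B' F', OpenTree C n' B' F' ∧ B ⊆ B' ∧ F ⊆ F' ∧ Reaches F' κ := by
  have facetDist_le : T.facetDist (T.facesOf C) κ v ≤ (p.length + 1 : ℕ) := by
    refine iInf₂_le_of_le u ⟨f, hf, hfu, hfκ⟩ ?_
    push_cast
    exact add_le_add_left (SimpleGraph.edist_le p) 1
  have cost_le {n' d : ℕ} (hn' : n' ≤ n + d) (hd : (d : ℝ≥0) ≤ k * (p.length + 1 : ℕ)) :
      (n' : ℝ≥0) ≤ n + k * (p.length + 1) :=
    calc (n' : ℝ≥0) ≤ n + d := by exact_mod_cast hn'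
      _ ≤ n + k * (p.length + 1) := by push_cast at hd; gcongr
  obtain dist_le | dist_le := min_le_iff.1 (hk.facet κ v hv)
  · obtain ⟨d, hd, hdk⟩ := exists_nat_eq_of_toENNReal_le dist_le facetDist_le
    obtain ⟨n', hn', B', F', h', hB, hF, hκ⟩ := h.exists_of_facetDist hd.le hvB
    exact ⟨n', cost_le hn' hdk, B', F', h', hB, hF, .inl hκ⟩
  · obtain ⟨d, hd, hdk⟩ := exists_nat_eq_of_toENNReal_le dist_le facetDist_le
    obtain ⟨n', hn', B', F', h', hB, hF, hκ⟩ := h.exists_of_twoFacetDist hd.le hvB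
    exact ⟨n', cost_le hn' hdk, B', F', h', hB, hF, .inr hκ⟩

end OpenTree

/-- An open tree through all boundary cells on a walk `p` inside the layer of `C`. It contains two
boundary cells `first` and `last` that are joined to the ends of `p`, and the number `n` of its
edges is at most `k` times what remains of the length of `p`. -/
structure WalkTree (C : Set T.Cell) (k : ℝ≥0) {a b : T.Cell}
    (p : (T.dualGraph (T.facesOf C)).Walk a b) where
  (n : ℕ) (B : Set T.Cell) (F : Set T.Face)
  tree : OpenTree C n B F
  (first last : T.Cell)
  head : (T.dualGraph (T.facesOf C)).Walk a first
  tail : (T.dualGraph (T.facesOf C)).Walk last b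
  first_mem : first ∈ B
  last_mem : last ∈ B
  first_mem_boundaryCells : first ∈ T.boundaryCells C
  last_mem_boundaryCells : last ∈ T.boundaryCells C
  mem_of_mem_support : ∀ c ∈ p.support, c ∈ T.boundaryCells C → c ∈ B
  cost_le : n + k * head.length + k * tail.length ≤ k * p.length

namespace WalkTree

variable {a b u : T.Cell} {p : (T.dualGraph (T.facesOf C)).Walk a b}

/-- The tree that consists of the starting point of a walk without other boundary cells. -/
def single (hu : a ∈ T.boundaryCells C)
    (hp : ∀ c ∈ p.support, c ∈ T.boundaryCells C → c = a) : WalkTree C k p where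
  n := 0
  B := {a}
  F := ∅
  tree := .single a
  first := a
  last := a
  head := .nil
  tail := p
  first_mem := rfl
  last_mem := rfl
  first_mem_boundaryCells := hu
  last_mem_boundaryCells := hu
  mem_of_mem_support := hp
  cost_le := by simp

/-- Prepending an edge from a cell that is not in the boundary to a walk. -/
def consOfNotMem (t : WalkTree C k p) (hu : u ∉ T.boundaryCells C)
    (hadj : (T.dualGraph (T.facesOf C)).Adj u a) : WalkTree C k (.cons hadj p) where
  __ := t
  head := .cons hadj t.head
  mem_of_mem_support := by
    rintro c (_ | ⟨_, hc⟩) hcb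
    exacts [absurd hcb hu, t.mem_of_mem_support c hc hcb]
  cost_le := by
    have cost_le := t.cost_le
    simp only [SimpleGraph.Walk.length_cons, Nat.cast_succ]
    calc t.n + k * (t.head.length + 1) + k * t.tail.length
        = t.n + k * t.head.length + k * t.tail.length + k := by ring
      _ ≤ k * p.length + k := by gcongr
      _ = k * (p.length + 1) := by ring

theorem nonempty_cons_of_mem (hk : T.DistBound C k) (t : WalkTree C k p)
    (hu : u ∈ T.boundaryCells C) (hadj : (T.dualGraph (T.facesOf C)).Adj u a) :
    Nonempty (WalkTree C k (.cons hadj p)) := by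
  obtain ⟨n, hn, B, F, tree, hB, huB⟩ := t.tree.exists_of_boundary_walk hk
    t.first_mem_boundaryCells hu t.first_mem (SimpleGraph.Walk.cons hadj t.head).reverse
  refine ⟨⟨n, B, F, tree, u, t.last, .nil, t.tail, huB, hB t.last_mem, hu,
    t.last_mem_boundaryCells, ?_, ?_⟩⟩
  · rintro c (_ | ⟨_, hc⟩) hcb
    exacts [huB, hB (t.mem_of_mem_support c hc hcb)]
  · have cost_le := t.cost_le
    simp only [SimpleGraph.Walk.length_reverse, SimpleGraph.Walk.length_cons,
      SimpleGraph.Walk.length_nil, Nat.cast_succ, Nat.cast_zero, mul_zero, add_zero] at hn ⊢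
    calc n + k * t.tail.length
        ≤ t.n + k * (t.head.length + 1) + k * t.tail.length := by gcongr
      _ = t.n + k * t.head.length + k * t.tail.length + k := by ring
      _ ≤ k * p.length + k := by gcongr
      _ = k * (p.length + 1) := by ring

end WalkTree

theorem DistBound.disjoint_or_nonempty_walkTree (hk : T.DistBound C k) {a b : T.Cell}
    (p : (T.dualGraph (T.facesOf C)).Walk a b) :
    (∀ c ∈ p.support, c ∉ T.boundaryCells C) ∨ Nonempty (WalkTree C k p) := by
  induction p with
  | @nil u =>
    by_cases hu : u ∈ T.boundaryCells C
    · exact .inr ⟨.single hu fun c hc _ => by simpa using hc⟩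
    · exact .inl (by simpa using hu)
  | @cons u w b hadj p ih =>
    by_cases hu : u ∈ T.boundaryCells C <;> obtain disjoint | ⟨⟨t⟩⟩ := ih
    · refine .inr ⟨.single hu ?_⟩
      rintro c (_ | ⟨_, hc⟩) hcb
      exacts [rfl, absurd hcb (disjoint c hc)]
    · exact .inr (t.nonempty_cons_of_mem hk hu hadj)
    · exact .inl (List.forall_mem_cons.2 ⟨hu, disjoint⟩)
    · exact .inr ⟨t.consOfNotMem hu hadj⟩

end TetrahedralColex

theorem eq_or_eq_of_card_eq_three {s t t' t'' : Finset (Fin 4)} (hs : s.card = 2) (ht : t.card = 3)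
    (hst : s ⊆ t) (ht' : t'.card = 3) (hst' : s ⊆ t') (hne : t ≠ t') (ht'' : t''.card = 3)
    (hst'' : s ⊆ t'') : t'' = t ∨ t'' = t' := by
  revert s t t' t''
  decide

theorem card_compl_singleton (κ : Fin 4) : ({κ}ᶜ : Finset (Fin 4)).card = 3 := by
  revert κ
  decide

namespace ColexGraph

variable {V : Type*} {G : ColexGraph V} {f : G.Face} {c c' d : G.Cell} {κ κ' : Fin 4}

theorem cell_eq_of_colors_eq (hc : G.IsFaceOf f c) (hc' : G.IsFaceOf f c')
    (h : c.1.1.1 = c'.1.1.1) : c = c' := by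
  obtain ⟨v, hv⟩ := f.1.nonempty
  exact Subtype.ext (Elem.ext_of_mem h (hc.2 hv) (hc'.2 hv))

theorem cell_eq_or_eq (hne : c ≠ c') (hc : G.IsFaceOf f c) (hc' : G.IsFaceOf f c')
    (hd : G.IsFaceOf f d) : d = c ∨ d = c' :=
  (eq_or_eq_of_card_eq_three f.2 c.2 hc.1 c'.2 hc'.1 (mt (cell_eq_of_colors_eq hc hc') hne) d.2
    hd.1).imp (cell_eq_of_colors_eq hd hc) (cell_eq_of_colors_eq hd hc')

theorem OnFacet.colors_ne (h : G.OnFacet κ f) (hc : G.IsFaceOf f c) : c.1.1.1 ≠ {κ}ᶜ := by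
  intro colors_eq
  obtain ⟨v, hv⟩ := f.1.nonempty
  refine c.1.2.2.2 ?_
  rw [c.1.eq_component (hc.2 hv), colors_eq]
  exact G.mem_component_symm (h.2 hv)

theorem OnFacet.cell_eq (h : G.OnFacet κ f) (hc : G.IsFaceOf f c) (hc' : G.IsFaceOf f c') :
    c = c' := by
  by_contra hne
  obtain colors_eq | colors_eq := eq_or_eq_of_card_eq_three f.2 c.2 hc.1 c'.2 hc'.1
    (mt (cell_eq_of_colors_eq hc hc') hne) (card_compl_singleton κ) h.1
  exacts [h.colors_ne hc colors_eq.symm, h.colors_ne hc' colors_eq.symm]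

theorem OnFacet.unique (h : G.OnFacet κ f) (h' : G.OnFacet κ' f) (hc : G.IsFaceOf f c) :
    κ = κ' := by
  by_contra hne
  exact (eq_or_eq_of_card_eq_three f.2 (card_compl_singleton κ) h.1 (card_compl_singleton κ') h'.1
    (by simpa using hne) c.2 hc.1).elim (h.colors_ne hc) (h'.colors_ne hc)

end ColexGraph

theorem exists_walk_detour {W : Type*} {H : SimpleGraph W} {u w x y : W} (p : H.Walk u w)
    (hx : x ∈ p.support) (hxy : H.Adj x y) :
    ∃ p' : H.Walk u w, p'.length = p.length + 2 ∧ p.support ⊆ p'.support ∧ y ∈ p'.support := by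
  obtain ⟨q, r, rfl⟩ := SimpleGraph.Walk.mem_support_iff_exists_append.1 hx
  refine ⟨(q.append (.cons hxy (.cons hxy.symm .nil))).append r, ?_, fun c hc => ?_, ?_⟩
  · simp only [SimpleGraph.Walk.length_append, SimpleGraph.Walk.length_cons,
      SimpleGraph.Walk.length_nil]
    lia
  · simp only [SimpleGraph.Walk.mem_support_append_iff] at hc ⊢
    exact hc.imp_left .inl
  · simp [SimpleGraph.Walk.mem_support_append_iff]

namespace TetrahedralColex

variable {V : Type*} {T : TetrahedralColex V} {φ ψ : Finset T.Face} {u : T.Cell}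

/-- A closed walk in the dual graph of `φ` through both cells of each face in `ψ`, with at most two
edges per face in `ψ`. -/
structure IsTour (ψ : Finset T.Face) (p : (T.dualGraph (φ : Set T.Face)).Walk u u) : Prop where
  subset : ψ ⊆ φ
  length_le : p.length ≤ 2 * ψ.card
  exists_ne : ∀ f ∈ ψ, ∃ c c', c ≠ c' ∧ T.IsFaceOf f c ∧ T.IsFaceOf f c'
  mem_support : ∀ f ∈ ψ, ∀ c, T.IsFaceOf f c → c ∈ p.support

theorem IsTour.exists_insert [DecidableEq T.Face] {p : (T.dualGraph (φ : Set T.Face)).Walk u u}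
    (hp : IsTour ψ p) {c : T.Cell} (hc : (T.dualGraph (φ : Set T.Face)).Reachable u c)
    (hcp : c ∉ p.support) : ∃ f ∉ ψ, ∃ p' : (T.dualGraph (φ : Set T.Face)).Walk u u,
      IsTour (insert f ψ) p' := by
  obtain ⟨q⟩ := hc
  obtain ⟨⟨⟨x, y⟩, adj⟩, -, hx, hy⟩ :=
    q.exists_boundary_dart {c | c ∈ p.support} p.start_mem_support hcp
  have ⟨hxy, f, hf, hfx, hfy⟩ := adj
  have hfψ : f ∉ ψ := fun h => hy (hp.mem_support f h y hfy)
  obtain ⟨p', length_eq, hsub, hy'⟩ := exists_walk_detour p hx adj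
  refine ⟨f, hfψ, p', Finset.insert_subset hf hp.subset, ?_, ?_, ?_⟩
  · rw [Finset.card_insert_of_notMem hfψ, length_eq]
    linarith [hp.length_le]
  · exact (Finset.forall_mem_insert ..).2 ⟨⟨x, y, hxy, hfx, hfy⟩, hp.exists_ne⟩
  · refine (Finset.forall_mem_insert ..).2 ⟨fun d hd => ?_, fun g hg d hd =>
      hsub (hp.mem_support g hg d hd)⟩
    obtain rfl | rfl := ColexGraph.cell_eq_or_eq hxy hfx hfy hd
    exacts [hsub hx, hy']

theorem exists_isTour (φ : Finset T.Face) (u : T.Cell) :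
    ∃ (ψ : Finset T.Face) (p : (T.dualGraph (φ : Set T.Face)).Walk u u), IsTour ψ p ∧
      ∀ c, (T.dualGraph (φ : Set T.Face)).Reachable u c → c ∈ p.support := by
  let toured : Set (Finset T.Face) :=
    {ψ | ∃ p : (T.dualGraph (φ : Set T.Face)).Walk u u, IsTour ψ p}
  have toured_finite : toured.Finite := φ.powerset.finite_toSet.subset fun ψ ⟨_, hp⟩ => by
    simpa using hp.subset
  have toured_nonempty : toured.Nonempty := ⟨∅, .nil, by simp, by simp, by simp, by simp⟩
  obtain ⟨ψ, ⟨p, hp⟩, maximal⟩ := toured_finite.exists_maximal toured_nonempty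
  refine ⟨ψ, p, hp, fun c hc => ?_⟩
  by_contra hcp
  obtain ⟨f, hf, tour⟩ := hp.exists_insert hc hcp
  exact hf (maximal tour (Finset.subset_insert f ψ) (Finset.mem_insert_self f ψ))

end TetrahedralColex

namespace TetrahedralColex

variable {V : Type*} {T : TetrahedralColex V} {C : Set T.Cell} {k K : ℝ≥0} {a b u : T.Cell}
  {φ : Finset T.Face} {f f' : T.Face} {κ κ' : Fin 4}

theorem forced_agreesOnCell_of_walk (hK : 1 ≤ K) (hT : T.Propagates C K) (hk : T.DistBound C k)
    (p : (T.dualGraph (T.facesOf C)).Walk a b) :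
    T.Forced (T.facesOf C)ᶜ (k * p.length * K) fun α _ => ∃ z ∈ cycleSpace,
      ∀ c ∈ p.support, c ∈ T.boundaryCells C → T.AgreesOnCell α z c := by
  obtain disjoint | ⟨⟨t⟩⟩ := hk.disjoint_or_nonempty_walkTree p
  · exact .of_forall fun _ _ _ => ⟨0, cycleSpace.zero_mem,
      fun c hc hcb => absurd hcb (disjoint c hc)⟩
  refine (t.tree.forced hK hT).mono ?_ fun _ _ _ ⟨z, hz, hzB, _⟩ =>
    ⟨z, hz, fun c hc hcb => hzB c (t.mem_of_mem_support c hc hcb)⟩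
  gcongr
  exact le_trans (by rw [add_assoc]; exact le_self_add) t.cost_le

theorem forced_agreesOnCell_of_facet_walk (hK : 1 ≤ K) (hT : T.Propagates C K)
    (hk : T.DistBound C k) (p : (T.dualGraph (T.facesOf C)).Walk a b) (hf : f ∈ T.facesOf C)
    (hfa : T.IsFaceOf f a) (hfκ : T.OnFacet κ f) :
    T.Forced (T.facesOf C)ᶜ (k * (p.length + 1) * K) fun α _ => ∃ z ∈ cycleSpace, z κ = 0 ∧
      ∀ c ∈ p.support, c ∈ T.boundaryCells C → T.AgreesOnCell α z c := by
  obtain disjoint | ⟨⟨t⟩⟩ := hk.disjoint_or_nonempty_walkTree p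
  · exact .of_forall fun _ _ _ =>
      ⟨0, cycleSpace.zero_mem, rfl, fun c hc hcb => absurd hcb (disjoint c hc)⟩
  obtain ⟨n, hn, B, F, tree, hB, -, reaches⟩ := t.tree.exists_of_facet_walk hk
    t.first_mem_boundaryCells t.first_mem t.head.reverse hf hfa hfκ
  refine (tree.forced hK hT).mono ?_ fun α τ hα ⟨z, hz, hzB, hzF⟩ =>
    ⟨z, hz, reaches.row_eq_zero hα.toIsPotential hz hzF,
      fun c hc hcb => hzB c (hB (t.mem_of_mem_support c hc hcb))⟩
  gcongr
  rw [SimpleGraph.Walk.length_reverse] at hn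
  calc (n : ℝ≥0) ≤ t.n + k * (t.head.length + 1) := hn
    _ = t.n + k * t.head.length + k := by ring
    _ ≤ k * p.length + k := by gcongr; exact le_self_add.trans t.cost_le
    _ = k * (p.length + 1) := by ring

theorem forced_agreesOnCell_zero_of_two_facet_walk (hK : 1 ≤ K) (hT : T.Propagates C K)
    (hk : T.DistBound C k) (p : (T.dualGraph (T.facesOf C)).Walk a b) (hf : f ∈ T.facesOf C)
    (hf' : f' ∈ T.facesOf C) (hfa : T.IsFaceOf f a) (hfb : T.IsFaceOf f' b)
    (hfκ : T.OnFacet κ f) (hfκ' : T.OnFacet κ' f') (hne : κ ≠ κ') :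
    T.Forced (T.facesOf C)ᶜ (k * (p.length + 2) * K) fun α _ =>
      ∀ c ∈ p.support, c ∈ T.boundaryCells C → T.AgreesOnCell α 0 c := by
  obtain disjoint | ⟨⟨t⟩⟩ := hk.disjoint_or_nonempty_walkTree p
  · exact .of_forall fun _ _ _ c hc hcb => absurd hcb (disjoint c hc)
  obtain ⟨n₁, hn₁, B₁, F₁, tree₁, hB₁, -, reaches⟩ := t.tree.exists_of_facet_walk hk
    t.first_mem_boundaryCells t.first_mem t.head.reverse hf hfa hfκ
  obtain ⟨n₂, hn₂, B₂, F₂, tree₂, hB₂, hF₂, reaches'⟩ := tree₁.exists_of_facet_walk hk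
    t.last_mem_boundaryCells (hB₁ t.last_mem) t.tail hf' hfb hfκ'
  refine (tree₂.forced hK hT).mono ?_ fun α τ hα ⟨z, hz, hzB, hzF⟩ c hc hcb => ?_
  · gcongr
    rw [SimpleGraph.Walk.length_reverse] at hn₁
    calc (n₂ : ℝ≥0) ≤ t.n + k * (t.head.length + 1) + k * (t.tail.length + 1) := by
          exact hn₂.trans (by gcongr)
      _ = t.n + k * t.head.length + k * t.tail.length + 2 * k := by ring
      _ ≤ k * p.length + 2 * k := by gcongr; exact t.cost_le
      _ = k * (p.length + 2) := by ring
  · have hz0 : z = 0 := eq_zero_of_mem_cycleSpace hz hne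
      ((reaches.mono hF₂).row_eq_zero hα.toIsPotential hz hzF)
      (reaches'.row_eq_zero hα.toIsPotential hz hzF)
    exact hz0 ▸ hzB c (hB₂ (hB₁ (t.mem_of_mem_support c hc hcb)))

open Classical in
/-- The faces in `φ` that belong to the connected component of the cell `u` in the dual graph
of `φ`. -/
noncomputable def componentFaces (φ : Finset T.Face) (u : T.Cell) : Finset T.Face :=
  φ.filter fun f => ∃ c, (T.dualGraph (φ : Set T.Face)).Reachable u c ∧ T.IsFaceOf f c

theorem mem_componentFaces : f ∈ componentFaces φ u ↔
    f ∈ φ ∧ ∃ c, (T.dualGraph (φ : Set T.Face)).Reachable u c ∧ T.IsFaceOf f c := by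
  simp [componentFaces]

theorem reachable_of_mem_componentFaces (hf : f ∈ componentFaces φ u) {c : T.Cell}
    (hc : T.IsFaceOf f c) : (T.dualGraph (φ : Set T.Face)).Reachable u c := by
  obtain ⟨hφ, c', hc', hfc'⟩ := mem_componentFaces.1 hf
  obtain rfl | hne := eq_or_ne c' c
  exacts [hc', hc'.trans (SimpleGraph.Adj.reachable ⟨hne, f, hφ, hfc', hc⟩)]

theorem dualGraph_mono {Φ Φ' : Set T.Face} (h : Φ ⊆ Φ') : T.dualGraph Φ ≤ T.dualGraph Φ' :=
  fun _ _ hadj => ⟨hadj.1, hadj.2.imp fun _ hf => ⟨h hf.1, hf.2⟩⟩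

theorem exists_tour_componentFaces (hφ : (φ : Set T.Face) ⊆ T.facesOf C)
    (ha : (T.dualGraph (φ : Set T.Face)).Reachable u a) :
    ∃ (ψ : Finset T.Face) (p : (T.dualGraph (T.facesOf C)).Walk a a), p.length ≤ 2 * ψ.card ∧
      ψ ⊆ componentFaces φ u ∧ (∀ f ∈ ψ, ∀ κ, ¬ T.OnFacet κ f) ∧
      ∀ c, (T.dualGraph (φ : Set T.Face)).Reachable u c → c ∈ p.support := by
  obtain ⟨ψ, p, hp, support⟩ := exists_isTour φ a
  refine ⟨ψ, p.mapLe (dualGraph_mono hφ), by simpa using hp.length_le, fun f hf => ?_,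
    fun f hf κ hκ => ?_, fun c hc => by simpa using support c (ha.symm.trans hc)⟩ <;>
    obtain ⟨c, c', hne, hfc, hfc'⟩ := hp.exists_ne f hf
  · exact mem_componentFaces.2
      ⟨hp.subset hf, c, ha.trans (⟨p.takeUntil c (hp.mem_support f hf c hfc)⟩), hfc⟩
  · exact hne (hκ.cell_eq hfc hfc')

/-- A single cycle gives the potential `α` on all boundary cells of the layer of `C` in the
component of `u` in the dual graph of `φ`, and it is compatible with all facets the component
touches. -/
def IsConstantOnComponent (C : Set T.Cell) (φ : Finset T.Face) (u : T.Cell)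
    (α : Fin 4 → V → Fin 4 → ZMod 2) : Prop :=
  ∃ z ∈ cycleSpace,
    (∀ c, (T.dualGraph (φ : Set T.Face)).Reachable u c → c ∈ T.boundaryCells C →
      T.AgreesOnCell α z c) ∧
    ∀ κ, ∀ f ∈ componentFaces φ u, T.OnFacet κ f → z κ = 0

theorem forced_isConstantOnComponent_of_two_facets (hK : 1 ≤ K) (hT : T.Propagates C K)
    (hk : T.DistBound C k) (hφ : (φ : Set T.Face) ⊆ T.facesOf C) (hf : f ∈ componentFaces φ u)
    (hf' : f' ∈ componentFaces φ u) (hfκ : T.OnFacet κ f) (hfκ' : T.OnFacet κ' f')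
    (hne : κ ≠ κ') :
    T.Forced (T.facesOf C)ᶜ (k * (2 * (componentFaces φ u).card) * K) fun α _ =>
      IsConstantOnComponent C φ u α := by
  obtain ⟨hfφ, a, ha, hfa⟩ := mem_componentFaces.1 hf
  obtain ⟨hfφ', b, hb, hfb⟩ := mem_componentFaces.1 hf'
  obtain ⟨ψ, p, length_le, hψ, hψκ, support⟩ := exists_tour_componentFaces hφ ha
  have hff : f ≠ f' := fun h => hne (hfκ.unique (h ▸ hfκ') hfa)
  have card_le : ψ.card + 2 ≤ (componentFaces φ u).card := by
    have hfψ' : f' ∉ ψ := fun h => hψκ f' h κ' hfκ'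
    have hfψ : f ∉ insert f' ψ := by
      rw [Finset.mem_insert]
      exact fun h => h.elim hff fun h => hψκ f h κ hfκ
    have card_eq : (insert f (insert f' ψ)).card = ψ.card + 2 := by
      rw [Finset.card_insert_of_notMem hfψ, Finset.card_insert_of_notMem hfψ']
    exact card_eq ▸ Finset.card_le_card (Finset.insert_subset hf (Finset.insert_subset hf' hψ))
  -- The tour passes through both facet cells, which cuts it into two walks between the facets.
  obtain ⟨q, r, rfl⟩ := SimpleGraph.Walk.mem_support_iff_exists_append.1 (support b hb)
  have forced_q := forced_agreesOnCell_zero_of_two_facet_walk hK hT hk q (hφ hfφ) (hφ hfφ')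
    hfa hfb hfκ hfκ' hne
  have forced_r := forced_agreesOnCell_zero_of_two_facet_walk hK hT hk r (hφ hfφ') (hφ hfφ)
    hfb hfa hfκ' hfκ hne.symm
  refine (forced_q.and forced_r).mono ?_ fun _ _ _ ⟨agrees_q, agrees_r⟩ =>
    ⟨0, cycleSpace.zero_mem, fun c hc hcb => ?_, fun _ _ _ _ => rfl⟩
  · rw [← add_mul, ← mul_add]
    gcongr
    rw [SimpleGraph.Walk.length_append] at length_le
    exact_mod_cast (show q.length + 2 + (r.length + 2) ≤ 2 * (componentFaces φ u).card by lia)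
  · exact ((SimpleGraph.Walk.mem_support_append_iff ..).1 (support c hc)).elim
      (agrees_q c · hcb) (agrees_r c · hcb)

theorem forced_isConstantOnComponent_of_one_facet (hK : 1 ≤ K) (hT : T.Propagates C K)
    (hk : T.DistBound C k) (hφ : (φ : Set T.Face) ⊆ T.facesOf C) (hf : f ∈ componentFaces φ u)
    (hfκ : T.OnFacet κ f) (unique : ∀ κ', ∀ f' ∈ componentFaces φ u, T.OnFacet κ' f' → κ = κ') :
    T.Forced (T.facesOf C)ᶜ (k * (2 * (componentFaces φ u).card) * K) fun α _ =>
      IsConstantOnComponent C φ u α := by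
  obtain ⟨hfφ, a, ha, hfa⟩ := mem_componentFaces.1 hf
  obtain ⟨ψ, p, length_le, hψ, hψκ, support⟩ := exists_tour_componentFaces hφ ha
  have card_le : ψ.card + 1 ≤ (componentFaces φ u).card := by
    have hfψ : f ∉ ψ := fun h => hψκ f h κ hfκ
    exact Finset.card_insert_of_notMem hfψ ▸ Finset.card_le_card (Finset.insert_subset hf hψ)
  refine (forced_agreesOnCell_of_facet_walk hK hT hk p (hφ hfφ) hfa hfκ).mono ?_
    fun _ _ _ ⟨z, hz, hzκ, agrees⟩ =>
      ⟨z, hz, fun c hc => agrees c (support c hc),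
        fun κ' f' hf' hfκ' => unique κ' f' hf' hfκ' ▸ hzκ⟩
  gcongr
  exact_mod_cast (show p.length + 1 ≤ 2 * (componentFaces φ u).card by lia)

theorem forced_isConstantOnComponent (hK : 1 ≤ K) (hT : T.Propagates C K) (hk : T.DistBound C k)
    (hφ : (φ : Set T.Face) ⊆ T.facesOf C) (u : T.Cell) :
    T.Forced (T.facesOf C)ᶜ (k * (2 * (componentFaces φ u).card) * K) fun α _ =>
      IsConstantOnComponent C φ u α := by
  by_cases no_facet : ∀ κ, ∀ f ∈ componentFaces φ u, ¬ T.OnFacet κ f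
  · obtain ⟨ψ, p, length_le, hψ, -, support⟩ :=
      exists_tour_componentFaces hφ (SimpleGraph.Reachable.refl u)
    refine (forced_agreesOnCell_of_walk hK hT hk p).mono ?_ fun _ _ _ ⟨z, hz, agrees⟩ =>
      ⟨z, hz, fun c hc => agrees c (support c hc), fun κ f hf hfκ => absurd hfκ (no_facet κ f hf)⟩
    gcongr
    have card_le := Finset.card_le_card hψ
    exact_mod_cast (show p.length ≤ 2 * (componentFaces φ u).card by lia)
  push Not at no_facet
  obtain ⟨κ, f, hf, hfκ⟩ := no_facet
  by_cases unique : ∀ κ', ∀ f' ∈ componentFaces φ u, T.OnFacet κ' f' → κ = κ'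
  · exact forced_isConstantOnComponent_of_one_facet hK hT hk hφ hf hfκ unique
  push Not at unique
  obtain ⟨κ', f', hf', hfκ', hne⟩ := unique
  exact forced_isConstantOnComponent_of_two_facets hK hT hk hφ hf hf' hfκ hfκ' hne

end TetrahedralColex

namespace ColexGraph

variable {V : Type*} {G : ColexGraph V} {α β : Fin 4 → V → Fin 4 → ZMod 2}
  {τ σ : G.Face → ZMod 2} {f : G.Face} {v : V}

theorem IsCoboundary.sum_faceValue_eq_zero (hα : G.IsCoboundary α τ) (v : V) :
    ∑ s ∈ Finset.powersetCard 2 Finset.univ, G.faceValue τ s v = 0 := by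
  have diagonal (κ) : α κ v κ = 0 := (hα.mem_rowSpace κ v).1
  have sum_rows : ∑ κ, ∑ l, α κ v l = 0 :=
    Finset.sum_eq_zero fun κ _ => (hα.mem_rowSpace κ v).2
  simp only [Fin.sum_univ_four, diagonal] at sum_rows
  rw [sum_powersetCard_two, hα.faceValue_eq 0 1 (by decide), hα.faceValue_eq 0 2 (by decide),
    hα.faceValue_eq 0 3 (by decide), hα.faceValue_eq 1 2 (by decide),
    hα.faceValue_eq 1 3 (by decide), hα.faceValue_eq 2 3 (by decide)]
  linear_combination sum_rows

theorem IsPotential.eq_zero_of_out_mem (hα : G.IsPotential α) {s : Finset (Fin 4)} {κ : Fin 4}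
    (hκ : κ ∉ s) (hout : G.out ∈ G.component s v) : α κ v = 0 := by
  rw [← hα.eq_of_mem_component hκ hout, hα.out]

theorem IsPotential.exists_isCoboundary (hα : G.IsPotential α) : ∃ τ, G.IsCoboundary α τ := by
  choose r hr using fun f : G.Face => f.1.nonempty
  refine ⟨fun f => ∑ κ ∈ f.1.1.1ᶜ, ∑ l ∈ f.1.1.1ᶜ, α κ (r f) l, hα, fun κ l hκl v => ?_⟩
  have diagonal (κ v) : α κ v κ = 0 := (hα.mem_rowSpace κ v).1
  have card_eq : ({κ, l}ᶜ : Finset (Fin 4)).card = 2 := by revert κ l; decide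
  by_cases hout : G.out ∈ G.component {κ, l}ᶜ v
  · rw [faceValue_eq_zero _ hout, hα.eq_zero_of_out_mem (by simp) hout,
      hα.eq_zero_of_out_mem (by simp) hout]
    rfl
  · let f : G.Face := ⟨G.elem {κ, l}ᶜ v (by omega) hout, card_eq⟩
    have hv : v ∈ G.verts f := G.mem_component_self _ v
    have row_eq (i) (hi : i ∉ f.1.1.1) : α i (r f) = α i v := hα.eq_of_mem f.1 hi hv (hr f)
    have compl_colors : f.1.1.1ᶜ = {κ, l} := compl_compl _
    refine (faceValue_of_mem _ f hv).trans ?_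
    rw [compl_colors, Finset.sum_pair hκl, Finset.sum_pair hκl, Finset.sum_pair hκl,
      row_eq κ (by simp [f, elem]), row_eq l (by simp [f, elem]), diagonal, diagonal, zero_add,
      add_zero]

theorem IsCoboundary.eq_zero_of_rows_eq_zero (hα : G.IsCoboundary α τ) (hv : v ∈ G.verts f)
    (h : ∀ κ ∉ f.1.1.1, α κ v = 0) : τ f = 0 := by
  obtain ⟨κ, l, hκl, hf⟩ := exists_eq_compl_pair f.2
  rw [← faceValue_of_mem τ f hv, hf, hα.faceValue_eq κ l hκl, h κ (by simp [hf]),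
    h l (by simp [hf])]
  rfl

theorem IsCoboundary.eq_of_rows_eq_add (hα : G.IsCoboundary α τ) (hβ : G.IsCoboundary β σ)
    {z : Fin 4 → Fin 4 → ZMod 2} (hz : z ∈ cycleSpace) (hv : v ∈ G.verts f)
    (h : ∀ κ ∉ f.1.1.1, β κ v = α κ v + z κ) : σ f = τ f := by
  obtain ⟨κ, l, hκl, hf⟩ := exists_eq_compl_pair f.2
  rw [← faceValue_of_mem σ f hv, ← faceValue_of_mem τ f hv, hf, hβ.faceValue_eq κ l hκl,
    hα.faceValue_eq κ l hκl, h κ (by simp [hf]), h l (by simp [hf]), Pi.add_apply, Pi.add_apply,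
    hz.1 l κ, add_add_add_comm, CharTwo.add_self_eq_zero, add_zero]

theorem Elem.nbr_mem_iff (x : G.Elem) {κ : Fin 4} (hκ : κ ∈ x.1.1) :
    G.nbr κ v ∈ x.1.2 ↔ v ∈ x.1.2 :=
  ⟨fun h => G.nbr_nbr κ v ▸ x.nbr_mem h hκ, fun h => x.nbr_mem h hκ⟩

open Classical in
/-- The family of rows that agrees with `α` on the cells in `S` and vanishes on all other cells
of the closed colex. -/
noncomputable def restrictRows (S : Set G.Cell) (α : Fin 4 → V → Fin 4 → ZMod 2) (κ : Fin 4)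
    (v : V) : Fin 4 → ZMod 2 :=
  if ∃ c ∈ S, c.1.1.1 = {κ}ᶜ ∧ v ∈ c.1.1.2 then α κ v else 0

theorem isPotential_restrictRows (S : Set G.Cell) (mem : ∀ κ v, α κ v ∈ rowSpace κ)
    (nbr : ∀ κ l v, l ≠ κ → α κ (G.nbr l v) = α κ v) : G.IsPotential (restrictRows S α) where
  mem_rowSpace κ v := by
    unfold restrictRows
    split_ifs
    exacts [mem κ v, (rowSpace κ).zero_mem]
  nbr κ l v hl := by
    classical
    have iff : (∃ c ∈ S, c.1.1.1 = {κ}ᶜ ∧ G.nbr l v ∈ c.1.1.2) ↔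
        ∃ c ∈ S, c.1.1.1 = {κ}ᶜ ∧ v ∈ c.1.1.2 :=
      exists_congr fun c => and_congr_right fun _ => and_congr_right fun hc =>
        c.1.nbr_mem_iff (by simpa [hc] using hl)
    rw [restrictRows, restrictRows, nbr κ l v hl]
    exact if_congr iff rfl rfl
  out κ := if_neg fun ⟨c, _, _, hout⟩ => c.1.2.2.2 hout

theorem restrictRows_of_mem {S : Set G.Cell} {c : G.Cell} {κ : Fin 4} (hcS : c ∈ S)
    (hc : c.1.1.1 = {κ}ᶜ) (hv : v ∈ c.1.1.2) : restrictRows S α κ v = α κ v :=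
  if_pos ⟨c, hcS, hc, hv⟩

theorem restrictRows_eq_zero {S : Set G.Cell} {κ : Fin 4}
    (h : ∀ c ∈ S, c.1.1.1 = {κ}ᶜ → v ∈ c.1.1.2 → α κ v = 0) : restrictRows S α κ v = 0 := by
  unfold restrictRows
  split_ifs with hv
  · obtain ⟨c, hcS, hc, hvc⟩ := hv
    exact h c hcS hc hvc
  · rfl

theorem isFaceOf_of_mem {c : G.Cell} {κ : Fin 4} (hc : c.1.1.1 = {κ}ᶜ) (hκ : κ ∉ f.1.1.1)
    (hv : v ∈ G.verts f) (hvc : v ∈ c.1.1.2) : G.IsFaceOf f c := by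
  refine (Elem.le_iff_of_mem hv hvc).2 ?_
  rwa [hc, Finset.subset_compl_comm, Finset.singleton_subset_iff, Finset.mem_compl]

theorem exists_cell_or_onFacet {κ : Fin 4} (hκ : κ ∉ f.1.1.1) (hv : v ∈ G.verts f) :
    (∃ c : G.Cell, c.1.1.1 = {κ}ᶜ ∧ v ∈ c.1.1.2) ∨
      G.OnFacet κ f ∧ G.out ∈ G.component {κ}ᶜ v := by
  by_cases hout : G.out ∈ G.component {κ}ᶜ v
  · have subset : f.1.1.1 ⊆ {κ}ᶜ := by
      rwa [Finset.subset_compl_comm, Finset.singleton_subset_iff, Finset.mem_compl]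
    refine .inr ⟨⟨subset, fun w hw => ?_⟩, hout⟩
    rw [verts, f.1.eq_component hv] at hw
    rw [G.component_eq hout]
    exact G.component_mono subset v hw
  · exact .inl ⟨⟨G.elem {κ}ᶜ v (card_compl_singleton κ).le hout, card_compl_singleton κ⟩, rfl,
      G.mem_component_self _ v⟩

end ColexGraph

namespace TetrahedralColex

variable {V : Type*} {T : TetrahedralColex V} {C : Set T.Cell} {k K : ℝ≥0}
  {φ : Finset T.Face} {φ' : Set T.Face} {α : Fin 4 → V → Fin 4 → ZMod 2} {τ : T.Face → ZMod 2}

theorem sum_eq_zero_of_symmDiff_mem_syndromes (hα : T.IsCoboundary α τ)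
    (hφ : (φ : Set T.Face) ∆ φ' ∈ T.syndromes) (hτ : ∀ f ∈ φ', τ f = 0) :
    ∑ f ∈ φ, τ f = 0 := by
  classical
  have := T.finite
  have := Fintype.ofFinite V
  have := Fintype.ofFinite T.Face
  obtain ⟨Q, -, hQ⟩ := hφ
  have ite_eq (f : T.Face) : (if f ∈ φ then τ f else 0) =
      ∑ v, τ f * (if v ∈ T.verts f then 1 else 0) * (if v ∈ Q then 1 else 0) := by
    have inter_eq : T.verts f ∩ {v | (if v ∈ Q then 1 else 0 : ZMod 2) = 1} = T.verts f ∩ Q := by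
      simp
    simp only [mul_assoc]
    rw [← Finset.mul_sum, sum_ite_mem_mul_eq_ncard, inter_eq]
    by_cases hf : f ∈ φ'
    · simp [hτ f hf]
    have mem_iff : f ∈ φ ↔ Odd (T.verts f ∩ Q).ncard := by
      simpa [Set.mem_symmDiff, hf] using Set.ext_iff.1 hQ f
    by_cases hfφ : f ∈ φ
    · rw [if_pos hfφ, ZMod.natCast_eq_one_iff_odd.2 (mem_iff.1 hfφ), mul_one]
    · rw [if_neg hfφ, ZMod.natCast_eq_zero_iff_even.2
        (Nat.not_odd_iff_even.1 (mt mem_iff.2 hfφ)), mul_zero]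
  calc ∑ f ∈ φ, τ f = ∑ f, if f ∈ φ then τ f else 0 := by simp
    _ = ∑ v, (∑ f, τ f * (if v ∈ T.verts f then 1 else 0)) * (if v ∈ Q then 1 else 0) := by
      simp only [ite_eq, Finset.sum_mul]
      exact Finset.sum_comm
    _ = 0 := Finset.sum_eq_zero fun v _ => by
      rw [← ColexGraph.sum_faceValue, hα.sum_faceValue_eq_zero, zero_mul]

/-- Adding the constant cycle to the potential on the cells of the component, and dropping it
elsewhere, gives a potential that vanishes on the boundary cells. Hence its coboundary vanishes
outside the layer. -/
theorem exists_isCoboundary_eq_on_componentFaces {u : T.Cell}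
    (hφ : (φ : Set T.Face) ⊆ T.facesOf C) (hφ' : φ' ⊆ (T.facesOf C)ᶜ)
    (hα : T.IsCoboundary α τ) (const : IsConstantOnComponent C φ u α) :
    ∃ β σ, T.IsCoboundary β σ ∧ (∀ f ∈ componentFaces φ u, σ f = τ f) ∧
      (∀ f ∈ φ, f ∉ componentFaces φ u → σ f = 0) ∧ ∀ f ∈ φ', σ f = 0 := by
  obtain ⟨z, hz, agrees, facet⟩ := const
  let S : Set T.Cell := {c | ∃ f ∈ componentFaces φ u, T.IsFaceOf f c}
  obtain ⟨σ, hσ⟩ := (ColexGraph.isPotential_restrictRows (α := fun κ v => α κ v + z κ) S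
    (fun κ v => (rowSpace κ).add_mem (hα.mem_rowSpace κ v) (hz.2 κ))
    fun κ l v hl => by rw [hα.nbr κ l v hl]).exists_isCoboundary
  refine ⟨_, σ, hσ, fun f hf => ?_, fun f hf hfu => ?_, fun f hf => ?_⟩
  · obtain ⟨v, hv⟩ := f.1.nonempty
    refine hα.eq_of_rows_eq_add hσ hz hv fun κ hκ => ?_
    obtain ⟨c, hc, hvc⟩ | ⟨hfκ, hout⟩ := ColexGraph.exists_cell_or_onFacet hκ hv
    · exact ColexGraph.restrictRows_of_mem ⟨f, hf, ColexGraph.isFaceOf_of_mem hc hκ hv hvc⟩ hc hvc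
    · have row_eq : α κ v + z κ = 0 := by
        rw [hα.eq_zero_of_out_mem (by simp) hout, facet κ f hf hfκ, add_zero]
      exact row_eq ▸ ColexGraph.restrictRows_eq_zero fun _ _ _ _ => row_eq
  · obtain ⟨v, hv⟩ := f.1.nonempty
    refine hσ.eq_zero_of_rows_eq_zero hv fun κ hκ =>
      ColexGraph.restrictRows_eq_zero fun c ⟨g, hg, hgc⟩ hc hvc => absurd ?_ hfu
    exact mem_componentFaces.2 ⟨hf, c, reachable_of_mem_componentFaces hg hgc,
      ColexGraph.isFaceOf_of_mem hc hκ hv hvc⟩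
  · obtain ⟨v, hv⟩ := f.1.nonempty
    refine hσ.eq_zero_of_rows_eq_zero hv fun κ hκ =>
      ColexGraph.restrictRows_eq_zero fun c ⟨g, hg, hgc⟩ hc hvc => ?_
    have boundary : c ∈ T.boundaryCells C := ⟨⟨g, hφ (mem_componentFaces.1 hg).1, hgc⟩,
      ⟨f, hφ' hf, ColexGraph.isFaceOf_of_mem hc hκ hv hvc⟩⟩
    rw [agrees c (reachable_of_mem_componentFaces hg hgc) boundary v hvc κ (by simp [hc])]
    exact CharTwo.add_self_eq_zero _

theorem sum_componentFaces_eq_zero {u : T.Cell} (hφ : (φ : Set T.Face) ⊆ T.facesOf C)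
    (hφ' : φ' ⊆ (T.facesOf C)ᶜ) (hsyn : (φ : Set T.Face) ∆ φ' ∈ T.syndromes)
    (hα : T.IsCoboundary α τ) (const : IsConstantOnComponent C φ u α) :
    ∑ f ∈ componentFaces φ u, τ f = 0 := by
  obtain ⟨_, σ, hσ, eq_on_component, zero_off_component, zero_off_layer⟩ :=
    exists_isCoboundary_eq_on_componentFaces hφ hφ' hα const
  calc ∑ f ∈ componentFaces φ u, τ f = ∑ f ∈ componentFaces φ u, σ f :=
        Finset.sum_congr rfl fun f hf => (eq_on_component f hf).symm
    _ = ∑ f ∈ φ, σ f :=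
        Finset.sum_subset (fun f hf => (mem_componentFaces.1 hf).1) zero_off_component
    _ = 0 := sum_eq_zero_of_symmDiff_mem_syndromes hσ hsyn zero_off_layer

theorem filter_connectedComponentMk_eq_componentFaces {c : T.Face → T.Cell}
    (hc : ∀ f ∈ φ, T.IsFaceOf f (c f)) (u : T.Cell)
    [DecidableEq (T.dualGraph (φ : Set T.Face)).ConnectedComponent] :
    {f ∈ φ | (T.dualGraph (φ : Set T.Face)).connectedComponentMk (c f) =
      (T.dualGraph (φ : Set T.Face)).connectedComponentMk u} = componentFaces φ u := by
  ext f
  rw [Finset.mem_filter, SimpleGraph.ConnectedComponent.eq]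
  exact ⟨fun ⟨hf, hu⟩ => mem_componentFaces.2 ⟨hf, c f, hu.symm, hc f hf⟩, fun hf =>
    have hfφ := (mem_componentFaces.1 hf).1
    ⟨hfφ, (reachable_of_mem_componentFaces hf (hc f hfφ)).symm⟩⟩

theorem forced_sum_eq_zero (hK : 1 ≤ K) (hT : T.Propagates C K) (hk : T.DistBound C k)
    (hφ : (φ : Set T.Face) ⊆ T.facesOf C) (hφ' : φ' ⊆ (T.facesOf C)ᶜ)
    (hsyn : (φ : Set T.Face) ∆ φ' ∈ T.syndromes) :
    T.Forced (T.facesOf C)ᶜ (k * (2 * φ.card) * K) fun _ τ => ∑ f ∈ φ, τ f = 0 := by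
  classical
  obtain rfl | ⟨f, hf⟩ := φ.eq_empty_or_nonempty
  · exact .of_forall fun _ _ _ => Finset.sum_empty
  have : Nonempty T.Cell := ⟨(hφ hf).choose⟩
  choose! c _ hc using fun f (hf : f ∈ φ) => hφ hf
  let key (f : T.Face) := (T.dualGraph (φ : Set T.Face)).connectedComponentMk (c f)
  have forced (i) (hi : i ∈ φ.image key) :
      T.Forced (T.facesOf C)ᶜ (k * (2 * (φ.filter fun f => key f = i).card) * K)
        fun _ τ => ∑ f ∈ φ with key f = i, τ f = 0 := by
    obtain ⟨g, -, rfl⟩ := Finset.mem_image.1 hi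
    rw [show ({f ∈ φ | key f = key g} : Finset T.Face) = componentFaces φ (c g) from
      filter_connectedComponentMk_eq_componentFaces hc (c g)]
    exact (forced_isConstantOnComponent hK hT hk hφ (c g)).mono le_rfl fun _ _ hα const =>
      sum_componentFaces_eq_zero hφ hφ' hsyn hα const
  refine (ColexGraph.Forced.forall_mem forced).mono (le_of_eq ?_) fun _ τ _ sum_eq_zero => ?_
  · rw [← Finset.sum_mul, ← Finset.mul_sum, ← Finset.mul_sum, ← Nat.cast_sum,
      ← Finset.card_eq_sum_card_image]
  · rw [← Finset.sum_fiberwise_of_maps_to fun f hf => Finset.mem_image_of_mem key hf]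
    exact Finset.sum_eq_zero sum_eq_zero

theorem closureCondition_of_distBound {kface : ℕ}
    (hface : ∀ c : T.Cell, {f : T.Face | T.IsFaceOf f c}.ncard ≤ kface)
    (hT : T.Propagates C (2 * ((kface - 1 : ℕ) : ℝ≥0))) (hk : T.DistBound C k) :
    T.ClosureCondition C (4 * k * ((kface : ℝ) - 1)) := by
  have := T.finite
  rintro φ ⟨hφ, φ', hφ', hsyn⟩
  obtain rfl | ⟨f, hf⟩ := φ.eq_empty_or_nonempty
  · exact ⟨∅, by simp, by simp, ∅, by simp, by ext; simp⟩
  obtain ⟨c, -, -⟩ := hφ hf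
  have two_le : 2 ≤ kface := (two_le_ncard_isFaceOf c).trans (hface c)
  have hK : (1 : ℝ≥0) ≤ 2 * ((kface - 1 : ℕ) : ℝ≥0) := mod_cast (by lia)
  obtain ⟨φ, rfl⟩ := φ.toFinite.exists_finset_coe
  obtain ⟨M, hM, card_M, forces⟩ := forced_sum_eq_zero hK hT hk hφ hφ' hsyn
  obtain ⟨ψ, hψ, hψsyn⟩ := T.exists_symmDiff_mem_syndromes (M := M) forces
  refine ⟨ψ, hψ.trans hM, ?_, hψsyn⟩
  rw [Set.ncard_coe_finset]
  calc (ψ.ncard : ℝ) ≤ M.card := by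
        rw [← Set.ncard_coe_finset]
        exact_mod_cast Set.ncard_le_ncard hψ
    _ ≤ k * (2 * φ.card) * (2 * (kface - 1 : ℕ)) := mod_cast card_M
    _ = 4 * k * ((kface : ℝ) - 1) * φ.card := by
        push_cast [show 1 ≤ kface by lia]
        ring

end TetrahedralColex

theorem mainTheorem3 {V : Type*} (T : TetrahedralColex V) (C : Set T.Cell) (kface : ℕ) (k : ℝ≥0)
    (hface : ∀ c : T.Cell, {f : T.Face | T.IsFaceOf f c}.ncard ≤ kface)
    (hsimple : ∀ c ∉ C, T.points c ∩ (⋃ c' ∈ C, T.points c') = ∅ ∨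
      IsSimplyConnected (T.points c ∩ (⋃ c' ∈ C, T.points c')))
    (hdist : ∀ v ∈ T.dualVertices (T.facesOf C) ∩ T.dualVertices (T.facesOf C)ᶜ,
      ∀ v' ∈ T.dualVertices (T.facesOf C) ∩ T.dualVertices (T.facesOf C)ᶜ,
        (T.dist (T.facesOf C)ᶜ v v' : ℝ≥0∞) ≤ k * (T.dist (T.facesOf C) v v' : ℝ≥0∞))
    (hfacet : ∀ (κ : Fin 4), ∀ v ∈ T.dualVertices (T.facesOf C) ∩ T.dualVertices (T.facesOf C)ᶜ,
      (min (T.facetDist (T.facesOf C)ᶜ κ v) (T.twoFacetDist (T.facesOf C)ᶜ v) : ℝ≥0∞) ≤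
        k * (T.facetDist (T.facesOf C) κ v : ℝ≥0∞)) :
    T.ClosureCondition C (4 * k * ((kface : ℝ) - 1)) :=
  T.closureCondition_of_distBound hface (TetrahedralColex.propagates hface hsimple)
    ⟨hdist, hfacet⟩
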